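/- Let $n\ge 2$, let $\mu$ be the standard Gaussian distribution on $\mathbb{R}^n$, and let $\sigma^2(x) := 1/(1+\|x\|^2)$ for $x\in\mathbb{R}^n$. Let $\mathcal L_\mu^\sigma$ be the closure in $L^2(\mu)$ of the operator $$\mathcal L_\mu^\sigma h(x) = \sigma^2(x)\,\Delta h(x) + \big(\nabla(\sigma^2)(x) - \sigma^2(x)\,x\big)\cdot\nabla h(x),\qquad h\in C_0^\infty(\mathbb{R}^n),$$ where $C_0^\infty(\mathbb{R}^n)$ is the space of smooth compactly supported functions (this operator is essentially self-adjoint, so that the closure is its unique self-adjoint extension), and let $\lambda_1(-\mathcal L_\mu^\sigma)$ be its spectral gap, that is, the largest real $\lambda$ such that the spectrum of $-\mathcal L_\mu^\sigma$ lies in $\{0\}\cup[\lambda,+\infty)$. Then this largest real exists, and $$\frac{n-1}{n(n+3)} \;\le\; \lambda_1(-\mathcal L_\mu^\sigma) \;\le\; \min\Big\{\frac{1}{n-2},\,1\Big\},$$ where $1/(n-2)$ is read as $+\infty$ when $n=2$. Consequently $\lambda_1(-\mathcal L_\mu^\sigma)\sim 1/n$ as $n\to\infty$, i.e. $n\,\lambda_1(-\mathcal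 L_\mu^\sigma)\to 1$; in particular it is of order $1/n$. -/

import Mathlib

open MeasureTheory ProbabilityTheory
open scoped ContDiff Gradient Laplacian RealInnerProductSpace

noncomputable section

namespace WeightedGaussian

/-! ### Spectrum and spectral gap of an unbounded operator on a real Hilbert space -/

section Spectrum

variable {H : Type*} [NormedAddCommGroup H] [InnerProductSpace ℝ H]

/-- `lam` is in the resolvent set of the unbounded operator `A` on `H`: the operator
`A - lam : D(A) → H` has a bounded everywhere defined two-sided inverse `R : H → D(A)`. -/
def IsResolventPoint (A : H →ₗ.[ℝ] H) (lam : ℝ) : Prop :=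
  ∃ R : H →L[ℝ] H,
    (∀ f : H, ∃ hf : R f ∈ A.domain, A ⟨R f, hf⟩ - lam • R f = f) ∧
    (∀ u : A.domain, R (A u - lam • (u : H)) = u)

/-- The spectrum of an unbounded operator (for a self-adjoint operator on a real Hilbert space this
is also the spectrum of its complexification, which is real). -/
def unboundedSpectrum (A : H →ₗ.[ℝ] H) : Set ℝ :=
  {lam | ¬ IsResolventPoint A lam}

/-- The real numbers `lam` such that the spectrum of `A` lies in `{0} ∪ [lam, +∞)`. -/
def gapSet (A : H →ₗ.[ℝ] H) : Set ℝ :=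
  {lam | unboundedSpectrum A ⊆ {0} ∪ Set.Ici lam}

/-- The spectral gap: the largest real `lam` such that the spectrum of `A`
lies in `{0} ∪ [lam, +∞)`. -/
def spectralGap (A : H →ₗ.[ℝ] H) : ℝ :=
  sSup (gapSet A)

end Spectrum

/-! ### The weighted Gaussian diffusion operator -/

/-- The standard Gaussian distribution on `ℝⁿ`. -/
abbrev gaussian (n : ℕ) : Measure (EuclideanSpace ℝ (Fin n)) :=
  stdGaussian (EuclideanSpace ℝ (Fin n))

/-- The differential expression
`σ² Δh + (∇(σ²) - σ² x) · ∇h`, the function `w` being the weight `σ²`. -/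
def generator {n : ℕ} (w h : EuclideanSpace ℝ (Fin n) → ℝ) (x : EuclideanSpace ℝ (Fin n)) : ℝ :=
  w x * (Δ h) x + ⟪(∇ w) x - w x • x, (∇ h) x⟫

theorem gradient_add' {n : ℕ} {f g : EuclideanSpace ℝ (Fin n) → ℝ}
    (hf : ContDiff ℝ ∞ f) (hg : ContDiff ℝ ∞ g) (x : EuclideanSpace ℝ (Fin n)) :
    (∇ (f + g)) x = (∇ f) x + (∇ g) x := by
  unfold gradient
  rw [fderiv_add (hf.differentiable (by simp) x) (hg.differentiable (by simp) x), map_add]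

theorem gradient_smul' {n : ℕ} {f : EuclideanSpace ℝ (Fin n) → ℝ} (c : ℝ)
    (hf : ContDiff ℝ ∞ f) (x : EuclideanSpace ℝ (Fin n)) :
    (∇ (c • f)) x = c • (∇ f) x := by
  unfold gradient
  rw [fderiv_const_smul (hf.differentiable (by simp) x)]
  simp

theorem generator_add {n : ℕ} (w : EuclideanSpace ℝ (Fin n) → ℝ)
    {f g : EuclideanSpace ℝ (Fin n) → ℝ}
    (hf : ContDiff ℝ ∞ f) (hg : ContDiff ℝ ∞ g) :
    generator w (f + g) = generator w f + generator w g := by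
  funext x
  have h2 : (2 : WithTop ℕ∞) ≤ ∞ := WithTop.coe_le_coe.2 (le_top : (2 : ℕ∞) ≤ ⊤)
  simp only [generator, Pi.add_apply, gradient_add' hf hg, inner_add_right,
    (hf.of_le h2).contDiffAt.laplacian_add (hg.of_le h2).contDiffAt]
  ring

theorem generator_smul {n : ℕ} (w : EuclideanSpace ℝ (Fin n) → ℝ) (c : ℝ)
    {f : EuclideanSpace ℝ (Fin n) → ℝ} (hf : ContDiff ℝ ∞ f) :
    generator w (c • f) = c • generator w f := by
  funext x
  have h2 : (2 : WithTop ℕ∞) ≤ ∞ := WithTop.coe_le_coe.2 (le_top : (2 : ℕ∞) ≤ ⊤)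
  simp only [generator, Pi.smul_apply, gradient_smul' c hf, real_inner_smul_right,
    InnerProductSpace.laplacian_smul c (hf.of_le h2).contDiffAt, smul_eq_mul]
  ring

/-- The graph in `L²(μ) × L²(μ)` of the operator `h ↦ σ² Δh + (∇(σ²) - σ² x) · ∇h` with domain
the space of smooth compactly supported functions. -/
def generatorGraph {n : ℕ} (w : EuclideanSpace ℝ (Fin n) → ℝ) :
    Submodule ℝ (Lp ℝ 2 (gaussian n) × Lp ℝ 2 (gaussian n)) where
  carrier := {p | ∃ h : EuclideanSpace ℝ (Fin n) → ℝ, ContDiff ℝ ∞ h ∧ HasCompactSupport h ∧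
    p.1 =ᵐ[gaussian n] h ∧ p.2 =ᵐ[gaussian n] generator w h}
  add_mem' := by
    rintro p q ⟨f, hf, hfc, hf1, hf2⟩ ⟨g, hg, hgc, hg1, hg2⟩
    refine ⟨f + g, hf.add hg, hfc.add hgc,
      (Lp.coeFn_add p.1 q.1).trans (hf1.add hg1), ?_⟩
    rw [generator_add w hf hg]
    exact (Lp.coeFn_add p.2 q.2).trans (hf2.add hg2)
  zero_mem' := by
    refine ⟨0, contDiff_const, HasCompactSupport.zero, Lp.coeFn_zero _ _ _, ?_⟩
    have h0 : generator w 0 = 0 := by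
      simpa using generator_smul w 0 (f := 0) contDiff_const
    rw [h0]
    exact Lp.coeFn_zero _ _ _
  smul_mem' := by
    rintro c p ⟨f, hf, hfc, hf1, hf2⟩
    refine ⟨c • f, hf.const_smul c, hfc.mono (Function.support_const_smul_subset c f),
      (Lp.coeFn_smul c p.1).trans (hf1.const_smul c), ?_⟩
    rw [generator_smul w c hf]
    exact (Lp.coeFn_smul c p.2).trans (hf2.const_smul c)

/-- Nonempty open sets have positive Gaussian measure. -/
theorem isOpenPosMeasure_gaussian (n : ℕ) : (gaussian n).IsOpenPosMeasure := by
  have h1 : (gaussianReal 0 1).IsOpenPosMeasure :=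
    (gaussianReal_absolutelyContinuous' 0 one_ne_zero).isOpenPosMeasure
  have h2 := (PiLp.continuous_toLp 2 (fun _ : Fin n => ℝ)).isOpenPosMeasure_map
    (μ := Measure.pi (fun _ : Fin n => gaussianReal 0 1)) (WithLp.toLp_surjective 2)
  rwa [map_pi_eq_stdGaussian] at h2

/-- `generatorGraph w` is the graph of an operator: a smooth function is determined by its class
in `L²(μ)`. -/
theorem generatorGraph_isGraph {n : ℕ} (w : EuclideanSpace ℝ (Fin n) → ℝ)
    (p : Lp ℝ 2 (gaussian n) × Lp ℝ 2 (gaussian n)) (hp : p ∈ generatorGraph w)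
    (hp1 : p.1 = 0) : p.2 = 0 := by
  obtain ⟨h, hh, -, h1, h2⟩ := hp
  have := isOpenPosMeasure_gaussian n
  have hz : h =ᵐ[gaussian n] 0 := by
    rw [hp1] at h1
    exact h1.symm.trans (Lp.coeFn_zero _ _ _)
  have h0 : h = 0 := (Continuous.ae_eq_iff_eq _ hh.continuous continuous_const).1 hz
  have hg : generator w 0 = 0 := by
    simpa using generator_smul w 0 (f := 0) contDiff_const
  rw [h0, hg] at h2
  exact (Lp.eq_zero_iff_ae_eq_zero).2 h2

/-- The operator `h ↦ σ² Δh + (∇(σ²) - σ² x) · ∇h` in `L²(μ)`, with domain the smooth compactly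
supported functions. -/
def minimalOperator {n : ℕ} (w : EuclideanSpace ℝ (Fin n) → ℝ) :
    Lp ℝ 2 (gaussian n) →ₗ.[ℝ] Lp ℝ 2 (gaussian n) :=
  (generatorGraph w).toLinearPMap

theorem minimalOperator_graph {n : ℕ} (w : EuclideanSpace ℝ (Fin n) → ℝ) :
    (minimalOperator w).graph = generatorGraph w :=
  Submodule.toLinearPMap_graph_eq _ (generatorGraph_isGraph w)

/-- The operator `L_μ^σ` in `L²(μ)`: the closure of the differential operator initially defined on
smooth compactly supported functions, which therefore form a core. -/
def diffusionOperator {n : ℕ} (w : EuclideanSpace ℝ (Fin n) → ℝ) :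
    Lp ℝ 2 (gaussian n) →ₗ.[ℝ] Lp ℝ 2 (gaussian n) :=
  (minimalOperator w).closure

/-- The weight `σ²(x) = 1 / (1 + ‖x‖²)`. -/
def sigmaSq (n : ℕ) (x : EuclideanSpace ℝ (Fin n)) : ℝ :=
  1 / (1 + ‖x‖ ^ 2)

/-- The spectral gap `λ₁(-L_μ^σ)` for the weight `σ²(x) = 1 / (1 + ‖x‖²)`. -/
def lambdaOne (n : ℕ) : ℝ :=
  spectralGap (-diffusionOperator (sigmaSq n))

end WeightedGaussian

end

/-! Write s = σ²(x), ρ for the Gaussian density, A = -L. Integration by parts gives ⟨A u, u⟩ = ∫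
σ²|∇u|² dμ on test functions, so A is symmetric and nonnegative there, and this passes to the closed
graph.

Self-adjointness: conjugation by (σ²ρ)^(-1/2) turns L - κ into σ² times Δ - W, with W ≥ 1 once κ =
3n/2 + 1. An L²(μ) function orthogonal to the range of L - κ thus yields an L² distributional
solution of ΔV = WV, which vanishes by mollification and a Caccioppoli inequality
(`ae_eq_zero_of_weak_schrodinger`). Hence -κ is a resolvent point of A, and this is the form in
which self-adjointness is used.

Lower bound: it suffices that c⟨A u, u⟩ ≤ ‖A u‖² with c = (n-1)/(n(n+3)), since the spectrum then
avoids (-∞, 0) and (0, c) (`isResolventPoint_of_lt`). The Bochner formula writes ‖A u‖² through the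
gradient and Hessian of u. A completed square with a free parameter α bounds the Hessian from below,
and a divergence of integral zero is added so that the term x·∇²u∇u, which has no sign, cancels.
What remains is a quadratic form in ∇u, checked for gradients orthogonal and parallel to x
(`coefficient_angular`, `coefficient_radial`).

Upper bound: a coordinate function lies in the domain, is orthogonal to the kernel, has norm 1 and
energy ∫ σ² dμ ≤ 1/(n-1). By `le_rayleigh_of_mem_gapSet`, whose core is that the best Poincaré
constant on the complement of the kernel belongs to the spectrum, the gap is at most 1/(n-1). This
is stronger than both 1 and 1/(n-2), and with the lower bound it gives the equivalent 1/n. -/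

noncomputable section

namespace WeightedGaussian

/-! ### Nonnegative self-adjoint operators: resolvent criteria, Poincaré inequality, spectral gap.
-/

section AbstractOperator

variable {H : Type*} [NormedAddCommGroup H] [InnerProductSpace ℝ H]

/-- The range of `A - lam` is closed when `A` has closed graph and `A - lam` is bounded below. -/
theorem isClosed_range_sub [CompleteSpace H] {A : H →ₗ.[ℝ] H}
    (hcl : IsClosed (A.graph : Set (H × H))) {lam δ : ℝ} (hδ : 0 < δ)
    (hlow : ∀ u : A.domain, δ * ‖(u : H)‖ ≤ ‖A u - lam • (u : H)‖) :
    IsClosed ((LinearMap.range (A.toFun - lam • A.domain.subtype) : Submodule ℝ H) : Set H) := by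
  refine IsSeqClosed.isClosed fun f f₀ hf hlim => ?_
  choose u hu using hf
  have hu' : ∀ k, A (u k) - lam • (u k : H) = f k := fun k => hu k
  have hcau : CauchySeq (fun k => (u k : H)) := by
    have hfc := hlim.cauchySeq
    rw [Metric.cauchySeq_iff'] at hfc ⊢
    intro ε hε
    obtain ⟨N, hN⟩ := hfc (δ * ε) (by positivity)
    refine ⟨N, fun k hk => ?_⟩
    have h1 := hN k hk
    rw [dist_eq_norm] at h1 ⊢
    have h2 := hlow (u k - u N)
    have h3 : A (u k - u N) - lam • ((u k - u N : A.domain) : H) = f k - f N := by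
      rw [LinearPMap.map_sub, ← hu' k, ← hu' N, AddSubgroupClass.coe_sub, smul_sub]; abel
    rw [h3] at h2
    rw [← AddSubgroupClass.coe_sub]
    exact lt_of_mul_lt_mul_left (h2.trans_lt h1) hδ.le
  obtain ⟨u₀, hu₀⟩ := cauchySeq_tendsto_of_complete hcau
  have hAu : Filter.Tendsto (fun k => A (u k)) Filter.atTop (nhds (f₀ + lam • u₀)) := by
    have : (fun k => A (u k)) = fun k => f k + lam • (u k : H) := by
      funext k; rw [← hu' k]; abel
    rw [this]
    exact hlim.add (hu₀.const_smul lam)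
  have hmem : (u₀, f₀ + lam • u₀) ∈ (A.graph : Set (H × H)) :=
    hcl.mem_of_tendsto (hu₀.prodMk_nhds hAu) (Filter.Eventually.of_forall fun k => A.mem_graph (u k))
  obtain ⟨w, hw1, hw2⟩ := (LinearPMap.mem_graph_iff A).1 hmem
  refine ⟨w, ?_⟩
  change A w - lam • (w : H) = f₀
  rw [hw2]
  have : (w : H) = u₀ := hw1
  rw [this]
  exact add_sub_cancel_right _ _

/-- A closed operator is bijective at `lam` if `A - lam` is bounded below with dense range. -/
theorem isResolventPoint_of_lower_bound [CompleteSpace H] {A : H →ₗ.[ℝ] H}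
    (hcl : IsClosed (A.graph : Set (H × H))) {lam δ : ℝ} (hδ : 0 < δ)
    (hlow : ∀ u : A.domain, δ * ‖(u : H)‖ ≤ ‖A u - lam • (u : H)‖)
    (horth : ∀ v : H, (∀ u : A.domain, ⟪v, A u - lam • (u : H)⟫ = 0) → v = 0) :
    IsResolventPoint A lam := by
  set T : A.domain →ₗ[ℝ] H := A.toFun - lam • A.domain.subtype
  have hTa : ∀ u, T u = A u - lam • (u : H) := fun u => rfl
  have hinj : Function.Injective T := by
    rw [← LinearMap.ker_eq_bot, LinearMap.ker_eq_bot']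
    intro u hu
    have h := hlow u
    rw [← hTa, hu, norm_zero] at h
    have : ‖(u : H)‖ = 0 := le_antisymm (nonpos_of_mul_nonpos_right h hδ) (norm_nonneg _)
    exact Subtype.ext (norm_eq_zero.1 this)
  have hsurj : Function.Surjective T := by
    rw [← LinearMap.range_eq_top]
    have hc := isClosed_range_sub hcl hδ hlow
    have : CompleteSpace (LinearMap.range T) := hc.completeSpace_coe
    rw [← Submodule.orthogonal_eq_bot_iff, Submodule.eq_bot_iff]
    intro v hv
    refine horth v fun u => ?_
    rw [Submodule.mem_orthogonal'] at hv
    exact hv _ ⟨u, rfl⟩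
  let e := LinearEquiv.ofBijective T ⟨hinj, hsurj⟩
  have he : ∀ f, T (e.symm f) = f := fun f => e.apply_symm_apply f
  let R : H →L[ℝ] H := (A.domain.subtype ∘ₗ e.symm.toLinearMap).mkContinuous δ⁻¹ (by
    intro f
    have h := hlow (e.symm f)
    rw [← hTa, he] at h
    rw [inv_mul_eq_div, le_div_iff₀' hδ]
    exact h)
  have hR : ∀ f, R f = ((e.symm f : A.domain) : H) := fun f => rfl
  refine ⟨R, fun f => ⟨(e.symm f).2, he f⟩, fun u => ?_⟩
  rw [hR, ← hTa]
  congr 1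
  exact hinj (he _)

/-- The properties of a nonnegative operator in a Hilbert space used below. -/
structure IsNonnegSymm (A : H →ₗ.[ℝ] H) : Prop where
  symm : ∀ u v : A.domain, ⟪A u, (v : H)⟫ = ⟪(u : H), A v⟫
  nonneg : ∀ u : A.domain, 0 ≤ ⟪A u, (u : H)⟫

variable {A : H →ₗ.[ℝ] H}

/-- Cauchy–Schwarz for the energy form, from the discriminant of the energy of u + t v. -/
theorem IsNonnegSymm.sq_inner_le (hA : IsNonnegSymm A) (u v : A.domain) :
    ⟪A u, (v : H)⟫ ^ 2 ≤ ⟪A u, (u : H)⟫ * ⟪A v, (v : H)⟫ := by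
  have h : ∀ t : ℝ, 0 ≤ ⟪A v, (v : H)⟫ * (t * t) + (2 * ⟪A u, (v : H)⟫) * t + ⟪A u, (u : H)⟫ := by
    intro t
    have h1 := hA.nonneg (u + t • v)
    have h2 : ⟪A v, (u : H)⟫ = ⟪A u, (v : H)⟫ := by rw [hA.symm v u, real_inner_comm]
    rw [LinearPMap.map_add, LinearPMap.map_smul, Submodule.coe_add, Submodule.coe_smul] at h1
    simp only [inner_add_left, inner_add_right, real_inner_smul_left, real_inner_smul_right] at h1
    rw [h2] at h1
    linarith
  have := discrim_le_zero h
  rw [discrim] at this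
  nlinarith

/-- Pairing A u + κ u with u gives the lower bound κ for free; only density of the range has to be
supplied. -/
theorem IsNonnegSymm.isResolventPoint_neg [CompleteSpace H] (hA : IsNonnegSymm A)
    (hcl : IsClosed (A.graph : Set (H × H))) {κ : ℝ} (hκ : 0 < κ)
    (horth : ∀ v : H, (∀ u : A.domain, ⟪v, A u + κ • (u : H)⟫ = 0) → v = 0) :
    IsResolventPoint A (-κ) := by
  refine isResolventPoint_of_lower_bound hcl hκ (fun u => ?_) (fun v hv => horth v fun u => ?_)
  · rw [neg_smul, sub_neg_eq_add]
    have h1 := real_inner_le_norm (A u + κ • (u : H)) (u : H)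
    rw [inner_add_left, real_inner_smul_left, real_inner_self_eq_norm_sq] at h1
    have h2 := hA.nonneg u
    rcases (norm_nonneg (u : H)).eq_or_lt with h0 | h0
    · rw [← h0, mul_zero]; positivity
    · have : κ * ‖(u : H)‖ * ‖(u : H)‖ ≤ ‖A u + κ • (u : H)‖ * ‖(u : H)‖ := by nlinarith
      exact le_of_mul_le_mul_right this h0
  · simpa [neg_smul, sub_neg_eq_add] using hv u

/-- A symmetric operator with `A + κ` surjective is self-adjoint. -/
theorem IsNonnegSymm.mem_domain_of_adjoint (hA : IsNonnegSymm A) {κ : ℝ}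
    (hres : IsResolventPoint A (-κ)) {v g : H}
    (hvg : ∀ u : A.domain, ⟪v, A u⟫ = ⟪g, (u : H)⟫) :
    ∃ w : A.domain, (w : H) = v ∧ A w = g := by
  obtain ⟨R, hR1, -⟩ := hres
  have hs : ∀ f : H, ∃ u : A.domain, A u + κ • (u : H) = f := fun f => by
    obtain ⟨h1, h2⟩ := hR1 f
    exact ⟨⟨R f, h1⟩, by simpa [neg_smul, sub_neg_eq_add] using h2⟩
  -- The vector w solves the equation that v satisfies weakly, so v - w is orthogonal to the range
  -- of A + κ. That range is all of H and contains v - w itself.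
  obtain ⟨w, hw⟩ := hs (g + κ • v)
  obtain ⟨u, hu⟩ := hs (v - w)
  have h0 : ⟪v - (w : H), v - (w : H)⟫ = 0 := by
    have h1 : ⟪(w : H), A u + κ • (u : H)⟫ = ⟪g + κ • v, (u : H)⟫ := by
      rw [← hw, inner_add_right, inner_add_left, ← hA.symm, real_inner_smul_left,
        real_inner_smul_right]
    have h2 : ⟪v, A u + κ • (u : H)⟫ = ⟪g + κ • v, (u : H)⟫ := by
      rw [inner_add_right, inner_add_left, hvg, real_inner_smul_left, real_inner_smul_right]
    nth_rewrite 2 [← hu]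
    rw [inner_sub_left, h1, h2, sub_self]
  have h3 : v = w := sub_eq_zero.1 (inner_self_eq_zero.1 h0)
  refine ⟨w, h3.symm, ?_⟩
  rw [← h3] at hw
  exact add_right_cancel hw

/-- If `A² ≥ c A` for a nonnegative self-adjoint operator, the spectrum avoids `(0, c)` and the
negative numbers. -/
theorem IsNonnegSymm.isResolventPoint_of_lt [CompleteSpace H] (hA : IsNonnegSymm A)
    (hcl : IsClosed (A.graph : Set (H × H))) {κ : ℝ} (hres : IsResolventPoint A (-κ)) {c : ℝ}
    (hc : ∀ u : A.domain, c * ⟪A u, (u : H)⟫ ≤ ‖A u‖ ^ 2) {lam : ℝ} (h0 : lam ≠ 0)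
    (hlt : lam < c) : IsResolventPoint A lam := by
  obtain ⟨δ, hδ, hlow⟩ : ∃ δ > 0, ∀ u : A.domain, δ * ‖(u : H)‖ ≤ ‖A u - lam • (u : H)‖ := by
    have hexp : ∀ u : A.domain, ‖A u - lam • (u : H)‖ ^ 2 =
        ‖A u‖ ^ 2 - 2 * lam * ⟪A u, (u : H)⟫ + lam ^ 2 * ‖(u : H)‖ ^ 2 := fun u => by
      rw [norm_sub_sq_real, norm_smul, mul_pow, Real.norm_eq_abs, sq_abs, real_inner_smul_right]
      ring
    have hfin : ∀ δ > 0, (∀ u : A.domain, δ ^ 2 * ‖(u : H)‖ ^ 2 ≤ ‖A u - lam • (u : H)‖ ^ 2) →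
        ∃ δ > 0, ∀ u : A.domain, δ * ‖(u : H)‖ ≤ ‖A u - lam • (u : H)‖ := fun δ hδ h =>
      ⟨δ, hδ, fun u => le_of_sq_le_sq (by rw [mul_pow]; exact h u) (norm_nonneg _)⟩
    -- The constant δ is the distance from lam to {0} ∪ [c, ∞): |lam| when lam is nearer to 0, c -
    -- lam when it is nearer to c.
    rcases le_or_gt (2 * lam) c with h | h
    · refine hfin |lam| (abs_pos.2 h0) fun u => ?_
      rw [hexp u, sq_abs]
      nlinarith [hc u, hA.nonneg u, mul_nonneg (sub_nonneg.2 h) (hA.nonneg u)]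
    · have hcp : 0 < c := by linarith
      refine hfin (c - lam) (sub_pos.2 hlt) fun u => ?_
      rw [hexp u]
      have h1 := sq_nonneg ‖A u - c • (u : H)‖
      have h2 : ‖A u - c • (u : H)‖ ^ 2 =
          ‖A u‖ ^ 2 - 2 * c * ⟪A u, (u : H)⟫ + c ^ 2 * ‖(u : H)‖ ^ 2 := by
        rw [norm_sub_sq_real, norm_smul, mul_pow, Real.norm_eq_abs, sq_abs, real_inner_smul_right]
        ring
      rw [h2] at h1
      -- After multiplication by c, the difference of the two sides is exactly `h3` plus twice `h4`.
      have h3 := mul_nonneg (sub_nonneg.2 h.le) h1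
      have h4 := mul_nonneg (sub_nonneg.2 hlt.le) (sub_nonneg.2 (hc u))
      refine le_of_mul_le_mul_left ?_ hcp
      nlinarith
  refine isResolventPoint_of_lower_bound hcl hδ hlow fun v hv => ?_
  obtain ⟨w, hw1, hw2⟩ := hA.mem_domain_of_adjoint hres (v := v) (g := lam • v) fun u => by
    have := hv u
    rw [inner_sub_right, real_inner_smul_right, sub_eq_zero] at this
    rw [this, real_inner_smul_left]
  have h := hlow w
  rw [hw2, hw1, sub_self, norm_zero] at h
  exact norm_eq_zero.1 (le_antisymm (nonpos_of_mul_nonpos_right h hδ) (norm_nonneg _))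

/-- Poincaré inequality on the orthogonal complement of the kernel. -/
theorem IsNonnegSymm.mul_norm_sq_le_of_orthogonal_ker [CompleteSpace H] (hA : IsNonnegSymm A)
    {κ : ℝ} (hres : IsResolventPoint A (-κ)) {c : ℝ} (hc0 : 0 < c)
    (hc : ∀ u : A.domain, c * ⟪A u, (u : H)⟫ ≤ ‖A u‖ ^ 2) (u : A.domain)
    (hu : ∀ k : A.domain, A k = 0 → ⟪(u : H), (k : H)⟫ = 0) :
    c * ‖(u : H)‖ ^ 2 ≤ ⟪A u, (u : H)⟫ := by
  -- By self-adjointness the orthogonal complement of the range is the kernel, so u is a limit of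
  -- vectors A v.
  have hcl : (u : H) ∈ closure (Set.range fun v : A.domain => A v) := by
    have : (u : H) ∈ (LinearMap.range A.toFun).topologicalClosure := by
      rw [← Submodule.orthogonal_orthogonal_eq_closure, Submodule.mem_orthogonal']
      intro k hk
      rw [Submodule.mem_orthogonal'] at hk
      obtain ⟨w, hw1, hw2⟩ := hA.mem_domain_of_adjoint hres (v := k) (g := 0) fun v => by
        rw [inner_zero_left]; exact hk _ ⟨v, rfl⟩
      rw [← hw1]
      exact hu w hw2
    exact this
  -- On the range, ⟨A v, u⟩² ≤ ⟨A v, v⟩⟨A u, u⟩ ≤ c⁻¹‖A v‖²⟨A u, u⟩. Both ends depend only on A v,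
  -- so the bound survives the closure and may be applied to u itself.
  have hle : ∀ v ∈ closure (Set.range fun v : A.domain => A v),
      c * ⟪v, (u : H)⟫ ^ 2 ≤ ‖v‖ ^ 2 * ⟪A u, (u : H)⟫ := by
    suffices h : closure (Set.range fun v : A.domain => A v) ⊆ {v : H | c * ⟪v, (u : H)⟫ ^ 2 ≤
      ‖v‖ ^ 2 * ⟪A u, (u : H)⟫} from fun v hv => h hv
    refine closure_minimal ?_ (isClosed_le (by fun_prop) (by fun_prop))
    rintro _ ⟨v, rfl⟩
    have h1 := hA.sq_inner_le v u
    have h2 := mul_le_mul_of_nonneg_right (hc v) (hA.nonneg u)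
    have h3 := mul_le_mul_of_nonneg_left h1 hc0.le
    simp only [Set.mem_ofPred_eq] at *
    nlinarith
  have h := hle _ hcl
  rw [real_inner_self_eq_norm_sq] at h
  rcases (norm_nonneg (u : H)).eq_or_lt with h0 | h0
  · rw [← h0]; simpa using hA.nonneg u
  · refine le_of_mul_le_mul_left ?_ (pow_pos h0 2)
    nlinarith

/-- Every element of `gapSet A` is bounded by the Rayleigh quotients of vectors orthogonal to the
kernel. -/
theorem IsNonnegSymm.le_rayleigh_of_mem_gapSet [CompleteSpace H] (hA : IsNonnegSymm A)
    {κ : ℝ} (hres : IsResolventPoint A (-κ)) {c : ℝ} (hc0 : 0 < c)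
    (hc : ∀ u : A.domain, c * ⟪A u, (u : H)⟫ ≤ ‖A u‖ ^ 2) (u₀ : A.domain) (hne : (u₀ : H) ≠ 0)
    (hu₀ : ∀ k : A.domain, A k = 0 → ⟪(u₀ : H), (k : H)⟫ = 0) {m : ℝ}
    (hm : ⟪A u₀, (u₀ : H)⟫ ≤ m * ‖(u₀ : H)‖ ^ 2) {lam : ℝ} (hlam : lam ∈ gapSet A) :
    lam ≤ m := by
  set S : Set ℝ := {r | ∀ u : A.domain, (∀ k : A.domain, A k = 0 → ⟪(u : H), (k : H)⟫ = 0) →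
    r * ‖(u : H)‖ ^ 2 ≤ ⟪A u, (u : H)⟫}
  have hcS : c ∈ S := fun u hu => hA.mul_norm_sq_le_of_orthogonal_ker hres hc0 hc u hu
  have hn0 : 0 < ‖(u₀ : H)‖ ^ 2 := by positivity
  have hub : ∀ r ∈ S, r ≤ m := fun r hr => le_of_mul_le_mul_right ((hr u₀ hu₀).trans hm) hn0
  have hbdd : BddAbove S := ⟨m, hub⟩
  set μ := sSup S
  have hμS : μ ∈ S := fun u hu => by
    rcases (norm_nonneg (u : H)).eq_or_lt with h0 | h0
    · rw [← h0]; simpa using hA.nonneg u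
    · rw [← le_div_iff₀ (by positivity)]
      refine csSup_le ⟨c, hcS⟩ fun r hr => ?_
      rw [le_div_iff₀ (by positivity)]
      exact hr u hu
  have hμpos : 0 < μ := hc0.trans_le (le_csSup hbdd hcS)
  -- A bounded inverse R of A - μ would let the optimal Poincaré constant μ be increased by 1/(‖R‖ +
  -- 1); the added 1 only covers ‖R‖ = 0.
  have hspec : μ ∈ unboundedSpectrum A := by
    rintro ⟨R, hR1, hR2⟩
    have hbig : μ + (‖R‖ + 1)⁻¹ ∈ S := by
      intro u hu
      set f : H := A u - μ • (u : H) with hf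
      have hgen : ∀ w : A.domain, (∀ k : A.domain, A k = 0 → ⟪(w : H), (k : H)⟫ = 0) →
          0 ≤ ⟪A w - μ • (w : H), (w : H)⟫ := fun w hw => by
        rw [inner_sub_left, real_inner_smul_left, real_inner_self_eq_norm_sq]
        exact sub_nonneg.2 (hμS w hw)
      obtain ⟨hy, hy2⟩ := hR1 (u : H)
      set y : A.domain := ⟨R u, hy⟩
      have hyorth : ∀ k : A.domain, A k = 0 → ⟪(y : H), (k : H)⟫ = 0 := fun k hk => by
        have h1 := hu k hk
        rw [← hy2, inner_sub_left, real_inner_smul_left, hA.symm y k, hk, inner_zero_right,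
          zero_sub, neg_eq_zero] at h1
        exact (mul_eq_zero.1 h1).resolve_left hμpos.ne'
      -- The form of A - μ is nonnegative at u + t y with y = R u, as y is also orthogonal to the
      -- kernel. The discriminant gives ‖u‖⁴ ≤ ⟨u, R u⟩⟨(A - μ)u, u⟩, which bounds the form below by
      -- a multiple of ‖u‖².
      have hquad : ∀ t : ℝ, 0 ≤ ⟪(u : H), (y : H)⟫ * (t * t) + (2 * ‖(u : H)‖ ^ 2) * t +
          ⟪f, (u : H)⟫ := by
        intro t
        have h1 := hgen (u + t • y) fun k hk => by
          rw [Submodule.coe_add, Submodule.coe_smul, inner_add_left, real_inner_smul_left,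
            hu k hk, hyorth k hk, mul_zero, add_zero]
        have h2 : A (u + t • y) - μ • ((u + t • y : A.domain) : H) = f + t • (u : H) := by
          rw [LinearPMap.map_add, LinearPMap.map_smul, Submodule.coe_add, Submodule.coe_smul]
          have h3 : A y = u + μ • (y : H) := by rw [← sub_eq_iff_eq_add]; exact hy2
          rw [hf, h3, smul_add, smul_add, smul_comm μ t]
          abel
        have h3 : ⟪f, (y : H)⟫ = ‖(u : H)‖ ^ 2 := by
          rw [hf, inner_sub_left, hA.symm, real_inner_smul_left, ← real_inner_smul_right,
            ← inner_sub_right, hy2, real_inner_self_eq_norm_sq]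
        rw [h2, Submodule.coe_add, Submodule.coe_smul, inner_add_left, inner_add_right,
          inner_add_right, real_inner_smul_left, real_inner_smul_right, real_inner_smul_left,
          real_inner_smul_right, h3, real_inner_self_eq_norm_sq] at h1
        linarith
      have hd := discrim_le_zero hquad
      rw [discrim] at hd
      have huy : ⟪(u : H), (y : H)⟫ ≤ (‖R‖ + 1) * ‖(u : H)‖ ^ 2 := by
        refine (real_inner_le_norm _ _).trans ?_
        have : ‖(y : H)‖ ≤ ‖R‖ * ‖(u : H)‖ := R.le_opNorm _
        nlinarith [norm_nonneg (u : H), norm_nonneg (y : H), sq_nonneg ‖(u : H)‖]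
      have hfu : ⟪f, (u : H)⟫ = ⟪A u, (u : H)⟫ - μ * ‖(u : H)‖ ^ 2 := by
        rw [hf, inner_sub_left, real_inner_smul_left, real_inner_self_eq_norm_sq]
      have hfu0 := hgen u hu
      rw [← hf] at hfu0
      have hRp : 0 < ‖R‖ + 1 := by positivity
      rcases (norm_nonneg (u : H)).eq_or_lt with h0 | h0
      · rw [← h0]; simpa using hA.nonneg u
      · have h4 : ‖(u : H)‖ ^ 2 ≤ (‖R‖ + 1) * ⟪f, (u : H)⟫ := by
          refine le_of_mul_le_mul_left ?_ (pow_pos h0 2)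
          nlinarith [mul_le_mul_of_nonneg_right huy hfu0]
        have h5 : (‖R‖ + 1)⁻¹ * ‖(u : H)‖ ^ 2 ≤ ⟪f, (u : H)⟫ := by
          rw [inv_mul_eq_div, div_le_iff₀' hRp]; exact h4
        rw [add_mul]
        linarith
    have := le_csSup hbdd hbig
    have hpos : 0 < (‖R‖ + 1)⁻¹ := by positivity
    linarith
  rcases hlam hspec with h | h
  · exact absurd h hμpos.ne'
  · exact (show lam ≤ μ from h).trans (hub μ hμS)

end AbstractOperator

/-- The gap set contains its supremum as soon as it is bounded above. -/
theorem isGreatest_spectralGap {H : Type*} [NormedAddCommGroup H] [InnerProductSpace ℝ H]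
    {A : H →ₗ.[ℝ] H} (hne : (gapSet A).Nonempty) (hb : BddAbove (gapSet A)) :
    IsGreatest (gapSet A) (spectralGap A) := by
  refine ⟨fun r hr => ?_, fun r hr => le_csSup hb hr⟩
  by_cases h0 : r = 0
  · exact Or.inl h0
  · exact Or.inr (csSup_le hne fun lam hlam => (hlam hr).resolve_left h0)

/-! ### Coordinate derivatives and the divergence form of the generator. -/

section PartialDerivatives

variable {n : ℕ}

/-- The partial derivative `∂ᵢ f`. -/
def pd (i : Fin n) (f : EuclideanSpace ℝ (Fin n) → ℝ) (x : EuclideanSpace ℝ (Fin n)) : ℝ :=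
  fderiv ℝ f x (EuclideanSpace.single i 1)

variable {f g : EuclideanSpace ℝ (Fin n) → ℝ} {i j : Fin n} {x : EuclideanSpace ℝ (Fin n)}

@[fun_prop]
theorem contDiff_pd (hf : ContDiff ℝ ∞ f) : ContDiff ℝ ∞ (pd i f) :=
  (hf.fderiv_right (m := ∞) (by simp)).clm_apply contDiff_const

theorem differentiable_of_contDiff (hf : ContDiff ℝ ∞ f) : Differentiable ℝ f :=
  hf.differentiable (by simp)

theorem hasCompactSupport_pd (hf : HasCompactSupport f) : HasCompactSupport (pd i f) :=
  hf.fderiv_apply ℝ _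

theorem pd_add (hf : DifferentiableAt ℝ f x) (hg : DifferentiableAt ℝ g x) :
    pd i (fun y => f y + g y) x = pd i f x + pd i g x := by
  simp [pd, fderiv_fun_add hf hg]

theorem pd_sub (hf : DifferentiableAt ℝ f x) (hg : DifferentiableAt ℝ g x) :
    pd i (fun y => f y - g y) x = pd i f x - pd i g x := by
  simp [pd, fderiv_fun_sub hf hg]

theorem pd_mul (hf : DifferentiableAt ℝ f x) (hg : DifferentiableAt ℝ g x) :
    pd i (fun y => f y * g y) x = f x * pd i g x + pd i f x * g x := by
  simp [pd, fderiv_fun_mul hf hg, mul_comm]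

theorem pd_sum {ι : Type*} (s : Finset ι) {f : ι → EuclideanSpace ℝ (Fin n) → ℝ}
    (hf : ∀ k ∈ s, DifferentiableAt ℝ (f k) x) :
    pd i (fun y => ∑ k ∈ s, f k y) x = ∑ k ∈ s, pd i (f k) x := by
  simp [pd, fderiv_fun_sum hf]

theorem pd_coord : pd i (fun y : EuclideanSpace ℝ (Fin n) => y j) x = if i = j then 1 else 0 := by
  have : (fun y : EuclideanSpace ℝ (Fin n) => y j) = EuclideanSpace.proj j (𝕜 := ℝ) := rfl
  rw [pd, this, ContinuousLinearMap.fderiv]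
  simp [eq_comm]

theorem pd_comp {φ : ℝ → ℝ} {φ' : ℝ} (hφ : HasDerivAt φ φ' (f x)) (hf : DifferentiableAt ℝ f x) :
    pd i (fun y => φ (f y)) x = φ' * pd i f x := by
  have := hφ.comp_hasFDerivAt x hf.hasFDerivAt
  rw [pd, show (fun y => φ (f y)) = φ ∘ f from rfl, this.fderiv]
  simp [pd]

theorem pd_norm_sq : pd i (fun y : EuclideanSpace ℝ (Fin n) => ‖y‖ ^ 2) x = 2 * x i := by
  rw [pd, fderiv_norm_sq_apply]
  simp [EuclideanSpace.inner_single_right]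

theorem pd_comm (hf : ContDiff ℝ ∞ f) : pd i (pd j f) x = pd j (pd i f) x := by
  have h2 : (2 : WithTop ℕ∞) ≤ ∞ := WithTop.coe_le_coe.2 (le_top : (2 : ℕ∞) ≤ ⊤)
  have hd : DifferentiableAt ℝ (fderiv ℝ f) x :=
    (hf.fderiv_right (m := ∞) (by simp)).differentiable (by simp) x
  have h : ∀ a b : Fin n, pd a (pd b f) x =
      fderiv ℝ (fderiv ℝ f) x (EuclideanSpace.single a 1) (EuclideanSpace.single b 1) := by
    intro a b
    simp only [pd, show (pd b f) = fun y => fderiv ℝ f y (EuclideanSpace.single b 1) from rfl]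
    rw [fderiv_clm_apply hd (differentiableAt_const _)]
    simp
  rw [h, h]
  exact (hf.contDiffAt.isSymmSndFDerivAt (by simpa using h2)).eq _ _

theorem gradient_apply : (∇ f) x i = pd i f x := by
  have : ⟪(∇ f) x, EuclideanSpace.single i (1 : ℝ)⟫ = pd i f x := by
    rw [gradient, InnerProductSpace.toDual_symm_apply, pd]
  rw [← this, EuclideanSpace.inner_single_right]
  simp

theorem laplacian_eq_sum_pd (hf : ContDiff ℝ ∞ f) : (Δ f) x = ∑ i, pd i (pd i f) x := by
  have hd : DifferentiableAt ℝ (fderiv ℝ f) x :=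
    (hf.fderiv_right (m := ∞) (by simp)).differentiable (by simp) x
  rw [congrFun (InnerProductSpace.laplacian_eq_iteratedFDeriv_orthonormalBasis f
    (EuclideanSpace.basisFun (Fin n) ℝ)) x]
  refine Finset.sum_congr rfl fun i _ => ?_
  rw [iteratedFDeriv_two_apply]
  simp only [pd, show (pd i f) = fun y => fderiv ℝ f y (EuclideanSpace.single i 1) from rfl]
  rw [fderiv_clm_apply hd (differentiableAt_const _)]
  simp

theorem sum_coord_sq : ∑ i, x i * x i = ‖x‖ ^ 2 := by
  rw [EuclideanSpace.real_norm_sq_eq]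
  simp [sq]

/-- This is ρ⁻¹ div(ρ w ∇h): the drift ∇w comes from the product rule and -w x from ∇ρ = -ρ x. -/
theorem generator_eq_sum {w h : EuclideanSpace ℝ (Fin n) → ℝ} (hw : ContDiff ℝ ∞ w)
    (hh : ContDiff ℝ ∞ h) :
    generator w h x = ∑ i, (pd i (fun y => w y * pd i h y) x - x i * (w x * pd i h x)) := by
  rw [generator, laplacian_eq_sum_pd hh, PiLp.inner_apply, Finset.mul_sum, ← Finset.sum_add_distrib]
  refine Finset.sum_congr rfl fun i _ => ?_
  rw [pd_mul (differentiable_of_contDiff hw x) (differentiable_of_contDiff (contDiff_pd hh) x)]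
  simp only [PiLp.sub_apply, PiLp.smul_apply, gradient_apply, smul_eq_mul]
  simp
  ring

end PartialDerivatives

/-! ### The Gaussian density and integration by parts. -/

section Density

/-- The density of the standard Gaussian distribution. -/
def gaussianDensity (n : ℕ) (x : EuclideanSpace ℝ (Fin n)) : ℝ :=
  (2 * Real.pi) ^ (-(n : ℝ) / 2) * Real.exp (-‖x‖ ^ 2 / 2)

variable {n : ℕ}

theorem gaussianDensity_pos (x : EuclideanSpace ℝ (Fin n)) : 0 < gaussianDensity n x := by
  unfold gaussianDensity; positivity

theorem contDiff_norm_sq' : ContDiff ℝ ∞ (fun x : EuclideanSpace ℝ (Fin n) => ‖x‖ ^ 2) :=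
  contDiff_norm_sq ℝ

@[fun_prop]
theorem contDiff_gaussianDensity : ContDiff ℝ ∞ (gaussianDensity n) := by
  unfold gaussianDensity
  have := contDiff_norm_sq' (n := n)
  fun_prop

@[fun_prop]
theorem measurable_gaussianDensity : Measurable (gaussianDensity n) :=
  contDiff_gaussianDensity.continuous.measurable

theorem integrable_gaussianDensity : Integrable (gaussianDensity n) := by
  have h := GaussianFourier.integrable_cexp_neg_mul_sq_norm_add (V := EuclideanSpace ℝ (Fin n))
    (b := 1 / 2) (by norm_num) 0 0
  have h2 := h.re.const_mul ((2 * Real.pi) ^ (-(n : ℝ) / 2))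
  refine h2.congr (Filter.Eventually.of_forall fun x => ?_)
  simp only [gaussianDensity]
  congr 1
  have : (-(1 / 2 : ℂ) * (‖x‖ : ℂ) ^ 2 + 0 * ((⟪(0 : EuclideanSpace ℝ (Fin n)), x⟫ : ℝ) : ℂ)) =
      ((-‖x‖ ^ 2 / 2 : ℝ) : ℂ) := by push_cast; ring
  rw [this, ← Complex.ofReal_exp]
  exact Complex.ofReal_re _

/-- Both measures are finite, so it is enough to compare characteristic functions. -/
theorem gaussian_eq_withDensity :
    gaussian n = volume.withDensity (fun x => ENNReal.ofReal (gaussianDensity n x)) := by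
  have hfin : IsFiniteMeasure (volume.withDensity
      (fun x : EuclideanSpace ℝ (Fin n) => ENNReal.ofReal (gaussianDensity n x))) :=
    isFiniteMeasure_withDensity_ofReal integrable_gaussianDensity.2
  refine Measure.ext_of_charFun ?_
  ext t
  rw [charFun_stdGaussian, charFun_apply, integral_withDensity_eq_integral_toReal_smul
    (by fun_prop) (by simp)]
  have h := GaussianFourier.integral_cexp_neg_mul_sq_norm_add (V := EuclideanSpace ℝ (Fin n))
    (b := 1 / 2) (by norm_num) Complex.I t
  have h3 : ∀ x : EuclideanSpace ℝ (Fin n),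
      (ENNReal.ofReal (gaussianDensity n x)).toReal • Complex.exp (⟪x, t⟫ * Complex.I) =
      ((2 * Real.pi : ℝ) ^ (-(n : ℝ) / 2) : ℝ) *
        Complex.exp (-(1 / 2) * ‖x‖ ^ 2 + Complex.I * ⟪t, x⟫) := by
    intro x
    rw [ENNReal.toReal_ofReal (gaussianDensity_pos x).le, gaussianDensity, Complex.real_smul,
      Complex.exp_add, real_inner_comm x t]
    push_cast
    rw [mul_assoc, mul_comm Complex.I]
    congr 3
    ring
  simp_rw [h3]
  rw [integral_const_mul, h]
  have h4 : (((2 * Real.pi : ℝ) ^ (-(n : ℝ) / 2) : ℝ) : ℂ) * (Real.pi / (1 / 2 : ℂ)) ^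
      ((Module.finrank ℝ (EuclideanSpace ℝ (Fin n)) : ℂ) / 2) = 1 := by
    have h5 : (Real.pi / (1 / 2 : ℂ)) = ((2 * Real.pi : ℝ) : ℂ) := by push_cast; ring
    have h6 : ((Module.finrank ℝ (EuclideanSpace ℝ (Fin n)) : ℂ) / 2) = ((n / 2 : ℝ) : ℂ) := by
      simp
    rw [h5, h6, ← Complex.ofReal_cpow (by positivity), ← Complex.ofReal_mul,
      ← Real.rpow_add (by positivity)]
    simp [neg_div]
  rw [← mul_assoc, h4, one_mul]
  congr 1
  rw [Complex.I_sq]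
  ring

theorem integral_gaussian (f : EuclideanSpace ℝ (Fin n) → ℝ) :
    ∫ x, f x ∂gaussian n = ∫ x, gaussianDensity n x * f x := by
  rw [gaussian_eq_withDensity, integral_withDensity_eq_integral_toReal_smul
    (by fun_prop) (by simp)]
  simp [ENNReal.toReal_ofReal (gaussianDensity_pos _).le]

theorem integrable_gaussian_iff (f : EuclideanSpace ℝ (Fin n) → ℝ) :
    Integrable f (gaussian n) ↔ Integrable (fun x => gaussianDensity n x * f x) := by
  rw [gaussian_eq_withDensity, integrable_withDensity_iff_integrable_smul₀' (by fun_prop) (by simp)]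
  simp [ENNReal.toReal_ofReal (gaussianDensity_pos _).le]

theorem volume_absolutelyContinuous_gaussian :
    (volume : Measure (EuclideanSpace ℝ (Fin n))) ≪ gaussian n := by
  rw [gaussian_eq_withDensity]
  refine withDensity_absolutelyContinuous' (by fun_prop) (Filter.Eventually.of_forall fun x => ?_)
  simpa using gaussianDensity_pos x

theorem gaussian_absolutelyContinuous_volume :
    gaussian n ≪ (volume : Measure (EuclideanSpace ℝ (Fin n))) := by
  rw [gaussian_eq_withDensity]
  exact withDensity_absolutelyContinuous _ _

theorem pd_gaussianDensity (i : Fin n) (x : EuclideanSpace ℝ (Fin n)) :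
    pd i (gaussianDensity n) x = -x i * gaussianDensity n x := by
  have h1 : HasDerivAt (fun t : ℝ => (2 * Real.pi) ^ (-(n : ℝ) / 2) * Real.exp (-t / 2))
      ((2 * Real.pi) ^ (-(n : ℝ) / 2) * (Real.exp (-(‖x‖ ^ 2) / 2) * (-1 / 2))) (‖x‖ ^ 2) :=
    (((hasDerivAt_id _).neg.div_const 2).exp).const_mul _
  have := pd_comp (i := i) (f := fun y : EuclideanSpace ℝ (Fin n) => ‖y‖ ^ 2) h1
    (differentiable_of_contDiff contDiff_norm_sq' x)
  change pd i (gaussianDensity n) x = _ at this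
  rw [this, pd_norm_sq, gaussianDensity]
  ring

/-- Gaussian integration by parts. -/
theorem integral_pd_gaussian {f : EuclideanSpace ℝ (Fin n) → ℝ} (i : Fin n)
    (hf : Differentiable ℝ f) (h0 : Integrable f (gaussian n))
    (h1 : Integrable (pd i f) (gaussian n)) (h2 : Integrable (fun x => x i * f x) (gaussian n)) :
    ∫ x, pd i f x ∂gaussian n = ∫ x, x i * f x ∂gaussian n := by
  rw [integrable_gaussian_iff] at h0 h1 h2
  rw [integral_gaussian, integral_gaussian]
  have hd : Differentiable ℝ (gaussianDensity n) := differentiable_of_contDiff (by fun_prop)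
  have h3 : ∀ x, fderiv ℝ (gaussianDensity n) x (EuclideanSpace.single i 1) =
      -x i * gaussianDensity n x := pd_gaussianDensity i
  have := integral_mul_fderiv_eq_neg_fderiv_mul_of_integrable (μ := volume)
    (f := gaussianDensity n) (g := f) (v := EuclideanSpace.single i 1)
    (h2.neg.congr (Filter.Eventually.of_forall fun x => by
      simp only [Pi.neg_apply, h3]; ring)) h1 h0 (fun x _ => hd x) (fun x _ => hf x)
  change ∫ x, gaussianDensity n x * pd i f x = _ at this
  rw [this, ← integral_neg]
  refine integral_congr_ae (Filter.Eventually.of_forall fun x => ?_)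
  simp only [h3]; ring

theorem integrable_of_hasCompactSupport {f : EuclideanSpace ℝ (Fin n) → ℝ}
    (hf : Continuous f) (hc : HasCompactSupport f) : Integrable f (gaussian n) :=
  hf.integrable_of_hasCompactSupport hc

theorem integral_pd_gaussian_of_hasCompactSupport {f : EuclideanSpace ℝ (Fin n) → ℝ} (i : Fin n)
    (hf : ContDiff ℝ ∞ f) (hc : HasCompactSupport f) :
    ∫ x, pd i f x ∂gaussian n = ∫ x, x i * f x ∂gaussian n :=
  integral_pd_gaussian i (differentiable_of_contDiff hf)
    (integrable_of_hasCompactSupport hf.continuous hc)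
    (integrable_of_hasCompactSupport (contDiff_pd hf).continuous (hasCompactSupport_pd hc))
    (integrable_of_hasCompactSupport (by have := hf.continuous; fun_prop) hc.mul_left)

/-- The adjoint `-∂ᵢ + xᵢ` of `∂ᵢ` in `L²(μ)`. -/
def pdAdj (i : Fin n) (f : EuclideanSpace ℝ (Fin n) → ℝ) (x : EuclideanSpace ℝ (Fin n)) : ℝ :=
  x i * f x - pd i f x

theorem contDiff_coord (i : Fin n) : ContDiff ℝ ∞ (fun x : EuclideanSpace ℝ (Fin n) => x i) := by
  fun_prop

@[fun_prop]
theorem contDiff_pdAdj {f : EuclideanSpace ℝ (Fin n) → ℝ} {i : Fin n} (hf : ContDiff ℝ ∞ f) :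
    ContDiff ℝ ∞ (pdAdj i f) := by
  unfold pdAdj
  fun_prop

/-- Compact support of g alone suffices, so f may be any smooth function. -/
theorem integral_mul_pdAdj {f g : EuclideanSpace ℝ (Fin n) → ℝ} (i : Fin n)
    (hf : ContDiff ℝ ∞ f) (hg : ContDiff ℝ ∞ g) (hc : HasCompactSupport g) :
    ∫ x, f x * pdAdj i g x ∂gaussian n = ∫ x, pd i f x * g x ∂gaussian n := by
  have h := integral_pd_gaussian_of_hasCompactSupport i (f := fun x => f x * g x)
    (hf.mul hg) hc.mul_left
  have h1 : Integrable (fun x => pd i f x * g x) (gaussian n) :=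
    integrable_of_hasCompactSupport (by fun_prop) hc.mul_left
  have h2 : Integrable (fun x => f x * pd i g x) (gaussian n) :=
    integrable_of_hasCompactSupport (by fun_prop) (hasCompactSupport_pd hc).mul_left
  have h3 : Integrable (fun x => x i * (f x * g x)) (gaussian n) :=
    integrable_of_hasCompactSupport (by fun_prop) hc.mul_left.mul_left
  have h4 : ∀ x, pd i (fun x => f x * g x) x = f x * pd i g x + pd i f x * g x := fun x =>
    pd_mul (differentiable_of_contDiff hf x) (differentiable_of_contDiff hg x)
  simp_rw [h4] at h
  rw [integral_add h2 h1] at h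
  have h5 : ∀ x, f x * pdAdj i g x = x i * (f x * g x) - f x * pd i g x := fun x => by
    rw [pdAdj]; ring
  simp_rw [h5]
  rw [integral_sub h3 h2, ← h]
  ring

/-- The commutation relation [∂ᵢ, ∂ⱼ*] = δᵢⱼ, source of the curvature term Σ Fᵢ² in the Bochner
formula. -/
theorem pd_pdAdj {f : EuclideanSpace ℝ (Fin n) → ℝ} (i j : Fin n) (hf : ContDiff ℝ ∞ f)
    (x : EuclideanSpace ℝ (Fin n)) :
    pd i (pdAdj j f) x = (if i = j then f x else 0) + pdAdj j (pd i f) x := by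
  have hd := differentiable_of_contDiff hf x
  have hx := differentiable_of_contDiff (contDiff_coord j) x
  have h1 : pd i (pdAdj j f) x = pd i (fun y => y j * f y - pd j f y) x := rfl
  rw [h1, pd_sub (hx.fun_mul hd) (differentiable_of_contDiff (contDiff_pd hf) x), pd_mul hx hd,
    pd_coord, pd_comm hf, pdAdj]
  split_ifs <;> ring

end Density

/-! ### Cutoff functions. -/

section Cutoff

variable {n : ℕ}

theorem hasCompactSupport_of_zero {f g : EuclideanSpace ℝ (Fin n) → ℝ} (hf : HasCompactSupport f)
    (h : ∀ x, f x = 0 → g x = 0) : HasCompactSupport g :=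
  hf.mono fun x hx hfx => hx (h x hfx)

theorem pd_comp_smul {f : EuclideanSpace ℝ (Fin n) → ℝ} (hf : Differentiable ℝ f) (c : ℝ)
    (i : Fin n) (x : EuclideanSpace ℝ (Fin n)) :
    pd i (fun y => f (c • y)) x = c * pd i f (c • x) := by
  have h1 : HasFDerivAt (fun y : EuclideanSpace ℝ (Fin n) => c • y)
      (c • ContinuousLinearMap.id ℝ (EuclideanSpace ℝ (Fin n))) x :=
    (hasFDerivAt_id x).const_smul c
  have h := (hf (c • x)).hasFDerivAt.comp x h1
  rw [pd, show (fun y => f (c • y)) = f ∘ fun y => c • y from rfl, h.fderiv]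
  simp [pd]

/-- Smooth cutoff functions with uniformly controlled derivatives. -/
theorem exists_cutoff (n : ℕ) : ∃ C : ℝ, 0 ≤ C ∧ ∃ χ : ℕ → EuclideanSpace ℝ (Fin n) → ℝ,
    ∀ k, ContDiff ℝ ∞ (χ k) ∧ HasCompactSupport (χ k) ∧ (∀ x, 0 ≤ χ k x ∧ χ k x ≤ 1) ∧
      (∀ x, ‖x‖ ≤ k + 1 → χ k x = 1) ∧ (∀ i x, |pd i (χ k) x| ≤ C / (k + 1)) ∧
      (∀ i x, |pd i (pd i (χ k)) x| ≤ C / (k + 1)) := by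
  -- One bump is rescaled by 1/(k+1), and each derivative yields such a factor. The square gained at
  -- second order is weakened to a single factor.
  let φ : ContDiffBump (0 : EuclideanSpace ℝ (Fin n)) := ⟨1, 2, one_pos, one_lt_two⟩
  have hφ : ContDiff ℝ ∞ φ := φ.contDiff
  have hφc : HasCompactSupport φ := φ.hasCompactSupport
  have hb1 : ∀ i : Fin n, ∃ C, ∀ x, ‖pd i φ x‖ ≤ C := fun i =>
    (hasCompactSupport_pd hφc).exists_bound_of_continuous (contDiff_pd hφ).continuous
  have hb2 : ∀ i : Fin n, ∃ C, ∀ x, ‖pd i (pd i φ) x‖ ≤ C := fun i =>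
    (hasCompactSupport_pd (hasCompactSupport_pd hφc)).exists_bound_of_continuous
      (contDiff_pd (contDiff_pd hφ)).continuous
  choose C1 hC1 using hb1
  choose C2 hC2 using hb2
  have hp1 : ∀ i, 0 ≤ C1 i := fun i => (norm_nonneg _).trans (hC1 i 0)
  have hp2 : ∀ i, 0 ≤ C2 i := fun i => (norm_nonneg _).trans (hC2 i 0)
  have hs : ∀ i, C1 i ≤ ∑ j, (C1 j + C2 j) ∧ C2 i ≤ ∑ j, (C1 j + C2 j) := fun i => by
    have := Finset.single_le_sum (f := fun j => C1 j + C2 j)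
      (fun j _ => add_nonneg (hp1 j) (hp2 j)) (Finset.mem_univ i)
    constructor <;> linarith [hp1 i, hp2 i]
  refine ⟨∑ j, (C1 j + C2 j), Finset.sum_nonneg fun j _ => add_nonneg (hp1 j) (hp2 j),
    fun k x => φ ((k + 1 : ℝ)⁻¹ • x), fun k => ?_⟩
  have hk : (0 : ℝ) < k + 1 := by positivity
  have hki : (k + 1 : ℝ)⁻¹ ≤ 1 := inv_le_one_of_one_le₀ (by linarith [Nat.cast_nonneg (α := ℝ) k])
  have e1 : ∀ i x, pd i (fun x => φ ((k + 1 : ℝ)⁻¹ • x)) x =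
      (k + 1 : ℝ)⁻¹ * pd i φ ((k + 1 : ℝ)⁻¹ • x) := fun i x =>
    pd_comp_smul (differentiable_of_contDiff hφ) _ i x
  have e2 : ∀ i x, pd i (pd i (fun x => φ ((k + 1 : ℝ)⁻¹ • x))) x =
      (k + 1 : ℝ)⁻¹ * ((k + 1 : ℝ)⁻¹ * pd i (pd i φ) ((k + 1 : ℝ)⁻¹ • x)) := fun i x => by
    rw [show pd i (fun x => φ ((k + 1 : ℝ)⁻¹ • x)) =
      fun x => (k + 1 : ℝ)⁻¹ * pd i φ ((k + 1 : ℝ)⁻¹ • x) from funext (e1 i),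
      pd_mul (differentiableAt_const _) ((differentiable_of_contDiff (f := fun x =>
        pd i φ ((k + 1 : ℝ)⁻¹ • x)) (by fun_prop)) x),
      pd_comp_smul (differentiable_of_contDiff (contDiff_pd hφ))]
    simp [pd]
  refine ⟨hφ.comp (contDiff_const_smul _), hφc.comp_homeomorph
    (Homeomorph.smulOfNeZero _ (inv_ne_zero hk.ne')), fun x => ⟨φ.nonneg, φ.le_one⟩,
    fun x hx => φ.one_of_mem_closedBall ?_, fun i x => ?_, fun i x => ?_⟩
  · rw [mem_closedBall_zero_iff, norm_smul, norm_inv, Real.norm_of_nonneg hk.le,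
      inv_mul_le_iff₀ hk]
    simpa [φ] using hx
  · rw [e1, abs_mul, abs_of_pos (inv_pos.2 hk), div_eq_inv_mul]
    exact mul_le_mul_of_nonneg_left ((hC1 i _).trans (hs i).1) (inv_pos.2 hk).le
  · rw [e2, abs_mul, abs_mul, abs_of_pos (inv_pos.2 hk), div_eq_inv_mul]
    refine mul_le_mul_of_nonneg_left ?_ (inv_pos.2 hk).le
    refine (mul_le_of_le_one_left (abs_nonneg _) hki).trans ((hC2 i _).trans (hs i).2)

end Cutoff

/-! ### Vanishing of square-integrable weak solutions of ΔV = WV with W ≥ 1. -/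

section Mollification

variable {n : ℕ}

/-- The mollification `x ↦ ∫ f(y) k(x - y) dy`. -/
def mollify (k f : EuclideanSpace ℝ (Fin n) → ℝ) (x : EuclideanSpace ℝ (Fin n)) : ℝ :=
  ∫ y, f y * k (x - y)

variable {k f : EuclideanSpace ℝ (Fin n) → ℝ}

theorem mollify_eq_convolution :
    mollify k f = convolution f k (ContinuousLinearMap.mul ℝ ℝ) volume := by
  funext x
  rw [convolution_def]
  rfl

theorem contDiff_mollify (hk : ContDiff ℝ ∞ k) (hkc : HasCompactSupport k)
    (hf : LocallyIntegrable f) : ContDiff ℝ ∞ (mollify k f) := by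
  rw [mollify_eq_convolution]
  exact hkc.contDiff_convolution_right _ hf hk

theorem pd_mollify (hk : ContDiff ℝ ∞ k) (hkc : HasCompactSupport k) (hf : LocallyIntegrable f)
    (i : Fin n) (x : EuclideanSpace ℝ (Fin n)) :
    pd i (mollify k f) x = mollify (pd i k) f x := by
  have h := hkc.hasFDerivAt_convolution_right (ContinuousLinearMap.mul ℝ ℝ) hf
    (hk.of_le (by simp)) x
  rw [pd, mollify_eq_convolution, h.fderiv, convolution_precompR_apply _ hf (hkc.fderiv ℝ)
    (hk.continuous_fderiv (by simp)), mollify_eq_convolution]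
  rfl

theorem integrable_mul_kernel (hk : Continuous k) (hkc : HasCompactSupport k)
    (hf : LocallyIntegrable f) (x : EuclideanSpace ℝ (Fin n)) :
    Integrable (fun y => f y * k (x - y)) :=
  hkc.convolutionExists_right (ContinuousLinearMap.mul ℝ ℝ) hf hk x

/-- Jensen's inequality: the variance of f under the probability density k(x - ·) is nonnegative. -/
theorem mollify_sq_le (hk : Continuous k) (hkc : HasCompactSupport k) (hk0 : ∀ x, 0 ≤ k x)
    (hk1 : ∫ x, k x = 1) (hf : MemLp f 2) (x : EuclideanSpace ℝ (Fin n)) :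
    mollify k f x ^ 2 ≤ mollify k (fun y => f y ^ 2) x := by
  have hfl : LocallyIntegrable f := hf.locallyIntegrable (by norm_num)
  have i1 := integrable_mul_kernel hk hkc hfl x
  have i2 := integrable_mul_kernel hk hkc hf.integrable_sq.locallyIntegrable x
  have i3 : Integrable (fun y => k (x - y)) :=
    (hk.integrable_of_hasCompactSupport hkc).comp_sub_left x
  have e3 : ∫ y, k (x - y) = 1 := by rw [integral_sub_left_eq_self k volume x, hk1]
  set c := mollify k f x with hc
  have h0 : 0 ≤ ∫ y, (f y - c) ^ 2 * k (x - y) :=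
    integral_nonneg fun y => mul_nonneg (sq_nonneg _) (hk0 _)
  have h1 : ∀ y, (f y - c) ^ 2 * k (x - y) =
      f y ^ 2 * k (x - y) - 2 * c * (f y * k (x - y)) + c ^ 2 * k (x - y) := fun y => by ring
  simp_rw [h1] at h0
  rw [integral_add (f := fun y => f y ^ 2 * k (x - y) - 2 * c * (f y * k (x - y)))
    (i2.sub (i1.const_mul _)) (i3.const_mul _), integral_sub i2 (i1.const_mul _),
    integral_const_mul, integral_const_mul, e3] at h0
  change 0 ≤ mollify k (fun y => f y ^ 2) x - 2 * c * mollify k f x + c ^ 2 * 1 at h0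
  rw [← hc] at h0
  linarith

/-- Mollification contracts L²: integrate the pointwise Jensen bound, the kernel having mass 1. -/
theorem integrable_mollify_sq (hk : ContDiff ℝ ∞ k) (hkc : HasCompactSupport k)
    (hk0 : ∀ x, 0 ≤ k x) (hk1 : ∫ x, k x = 1) (hf : MemLp f 2) :
    Integrable (fun x => mollify k f x ^ 2) ∧
      ∫ x, mollify k f x ^ 2 ≤ ∫ x, f x ^ 2 := by
  have hki := hk.continuous.integrable_of_hasCompactSupport hkc (μ := volume)
  have hI : Integrable (mollify k (fun y => f y ^ 2)) :=
    mollify_eq_convolution ▸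
      hf.integrable_sq.integrable_convolution (ContinuousLinearMap.mul ℝ ℝ) hki
  have hc := (contDiff_mollify hk hkc (hf.locallyIntegrable (by norm_num))).continuous
  have hle := mollify_sq_le hk.continuous hkc hk0 hk1 hf
  have hI2 : Integrable (fun x => mollify k f x ^ 2) :=
    hI.mono' (by fun_prop) (Filter.Eventually.of_forall fun x => by
      rw [Real.norm_of_nonneg (sq_nonneg _)]; exact hle x)
  refine ⟨hI2, (integral_mono hI2 hI hle).trans_eq ?_⟩
  have := integral_convolution (ContinuousLinearMap.mul ℝ ℝ) hf.integrable_sq hki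
  rw [hk1, ← mollify_eq_convolution] at this
  simpa using this

theorem integral_pd_eq_zero {f : EuclideanSpace ℝ (Fin n) → ℝ} (i : Fin n) (hf : ContDiff ℝ ∞ f)
    (hc : HasCompactSupport f) : ∫ x, pd i f x = 0 := by
  have h1 : Integrable (fun x => fderiv ℝ f x (EuclideanSpace.single i 1)) :=
    (contDiff_pd (i := i) hf).continuous.integrable_of_hasCompactSupport (hasCompactSupport_pd hc)
  have h2 : Integrable f := hf.continuous.integrable_of_hasCompactSupport hc
  have := integral_mul_fderiv_eq_neg_fderiv_mul_of_integrable (μ := volume)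
    (f := fun _ : EuclideanSpace ℝ (Fin n) => (1 : ℝ)) (g := f) (v := EuclideanSpace.single i 1)
    (by simp) (by simpa using h1) (by simpa using h2)
    (fun x _ => differentiableAt_const _) (fun x _ => differentiable_of_contDiff hf x)
  simpa [pd] using this

/-- Caccioppoli inequality. -/
theorem integral_sq_mul_laplacian_le {u χ : EuclideanSpace ℝ (Fin n) → ℝ} (hu : ContDiff ℝ ∞ u)
    (hχ : ContDiff ℝ ∞ χ) (hc : HasCompactSupport χ) :
    ∫ x, χ x ^ 2 * (u x * ∑ i, pd i (pd i u) x) ≤ ∫ x, (∑ i, pd i χ x ^ 2) * u x ^ 2 := by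
  have h1 : ∀ i : Fin n, ∫ x, pd i (fun y => χ y * (χ y * (u y * pd i u y))) x = 0 := fun i =>
    integral_pd_eq_zero i (by fun_prop) hc.mul_right
  have h2 : ∀ (i : Fin n) x, pd i (fun y => χ y * (χ y * (u y * pd i u y))) x =
      χ x ^ 2 * (u x * pd i (pd i u) x) + χ x ^ 2 * pd i u x ^ 2 +
        2 * (χ x * pd i χ x * u x * pd i u x) := fun i x => by
    have d1 := differentiable_of_contDiff hχ x
    have d2 := differentiable_of_contDiff hu x
    have d3 := differentiable_of_contDiff (contDiff_pd (i := i) hu) x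
    rw [pd_mul d1 (d1.fun_mul (d2.fun_mul d3)), pd_mul d1 (d2.fun_mul d3), pd_mul d2 d3]
    ring
  have hcs : HasCompactSupport (fun x => χ x ^ 2) :=
    hasCompactSupport_of_zero hc fun x hx => by simp [hx]
  have iA : ∀ i : Fin n, Integrable (fun x => χ x ^ 2 * (u x * pd i (pd i u) x)) := fun i =>
    Continuous.integrable_of_hasCompactSupport
      (ContDiff.continuous (𝕜 := ℝ) (n := ∞) (by fun_prop)) hcs.mul_right
  have iB : ∀ i : Fin n, Integrable (fun x => pd i χ x ^ 2 * u x ^ 2) := fun i =>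
    Continuous.integrable_of_hasCompactSupport
      (ContDiff.continuous (𝕜 := ℝ) (n := ∞) (by fun_prop)) 
      (hasCompactSupport_of_zero (hasCompactSupport_pd (i := i) hc) fun x hx => by simp [hx])
  have key : ∀ i : Fin n, ∫ x, χ x ^ 2 * (u x * pd i (pd i u) x) ≤
      ∫ x, pd i χ x ^ 2 * u x ^ 2 := fun i => by
    have iD : Integrable (fun x => pd i (fun y => χ y * (χ y * (u y * pd i u y))) x) :=
      Continuous.integrable_of_hasCompactSupport
        (ContDiff.continuous (𝕜 := ℝ) (n := ∞) (by fun_prop)) (hasCompactSupport_pd hc.mul_right)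
    have : ∫ x, (χ x ^ 2 * (u x * pd i (pd i u) x) -
        pd i (fun y => χ y * (χ y * (u y * pd i u y))) x) ≤ ∫ x, pd i χ x ^ 2 * u x ^ 2 := by
      refine integral_mono ((iA i).sub iD) (iB i) fun x => ?_
      simp only [h2]
      -- The right side minus the left side is exactly this square.
      nlinarith [sq_nonneg (χ x * pd i u x + pd i χ x * u x)]
    rwa [integral_sub (iA i) iD, h1, sub_zero] at this
  simp_rw [Finset.mul_sum, Finset.sum_mul]
  rw [integral_finsetSum _ fun i _ => iA i, integral_finsetSum _ fun i _ => iB i]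
  exact Finset.sum_le_sum fun i _ => key i

theorem abs_mollify_le (hk0 : ∀ x, 0 ≤ k x) (x : EuclideanSpace ℝ (Fin n)) :
    |mollify k f x| ≤ mollify k (fun y => |f y|) x := by
  refine (abs_integral_le_integral_abs).trans_eq ?_
  simp only [abs_mul, abs_of_nonneg (hk0 _)]
  rfl

/-- Essential self-adjointness of Schrödinger operators with continuous potential, bounded below:
an `L²` distributional solution of `Δ V = W V` with `W ≥ 1` vanishes. -/
theorem ae_eq_zero_of_weak_schrodinger {V W : EuclideanSpace ℝ (Fin n) → ℝ} (hV : MemLp V 2)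
    (hW : Continuous W) (hW1 : ∀ x, 1 ≤ W x)
    (h : ∀ ψ : EuclideanSpace ℝ (Fin n) → ℝ, ContDiff ℝ ∞ ψ → HasCompactSupport ψ →
      ∫ x, V x * (∑ i, pd i (pd i ψ) x - W x * ψ x) = 0) : V =ᵐ[volume] 0 := by
  obtain ⟨C, -, χ, hχ⟩ := exists_cutoff n
  have hVl : LocallyIntegrable V := hV.locallyIntegrable (by norm_num)
  have hVa : MemLp (fun y => |V y|) 2 := hV.abs
  have hVal : LocallyIntegrable (fun y => |V y|) := hVa.locallyIntegrable (by norm_num)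
  -- W may be unbounded, so the mollification radius depends on k: uniform continuity near the
  -- support of χₖ makes W oscillate by at most 1/(k+1) at that scale.
  have hosc : ∀ k : ℕ, ∃ δ : ℝ, 0 < δ ∧ δ ≤ 1 / (k + 1) ∧ ∀ x ∈ tsupport (χ k), ∀ y,
      dist x y < δ → |W x - W y| ≤ 1 / (k + 1) := fun k => by
    have hcomp : IsCompact (Metric.cthickening 1 (tsupport (χ k))) :=
      (hχ k).2.1.isCompact.cthickening
    have hu := hcomp.uniformContinuousOn_of_continuous hW.continuousOn
    rw [Metric.uniformContinuousOn_iff] at hu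
    have hk : (0 : ℝ) < 1 / (k + 1) := by positivity
    obtain ⟨δ, hδ, hu⟩ := hu _ hk
    refine ⟨min δ (1 / (k + 1)), lt_min hδ hk, min_le_right _ _, fun x hx y hxy => ?_⟩
    refine (hu x (Metric.self_subset_cthickening _ hx) y ?_ (hxy.trans_le (min_le_left _ _))).le
    refine Metric.mem_cthickening_of_dist_le y x _ _ hx ?_
    rw [dist_comm]
    refine (hxy.le.trans (min_le_right _ _)).trans ?_
    rw [div_le_one (by positivity)]
    linarith [Nat.cast_nonneg (α := ℝ) k]
  choose δ hδ0 hδ1 hδ using hosc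
  let φ : ℕ → ContDiffBump (0 : EuclideanSpace ℝ (Fin n)) := fun k =>
    ⟨δ k / 2, δ k, half_pos (hδ0 k), half_lt_self (hδ0 k)⟩
  set η : ℕ → EuclideanSpace ℝ (Fin n) → ℝ := fun k => (φ k).normed volume with hη
  have hη0 : ∀ k x, 0 ≤ η k x := fun k x => (φ k).nonneg_normed x
  have hη1 : ∀ k, ∫ x, η k x = 1 := fun k => (φ k).integral_normed
  have hηc : ∀ k, HasCompactSupport (η k) := fun k => (φ k).hasCompactSupport_normed
  have hηs : ∀ k, ContDiff ℝ ∞ (η k) := fun k => (φ k).contDiff_normed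
  have hηz : ∀ k x, δ k ≤ ‖x‖ → η k x = 0 := fun k x hx => by
    have : x ∉ Function.support (η k) := by
      rw [(φ k).support_normed_eq, mem_ball_zero_iff]
      exact not_lt.2 hx
    simpa using this
  set u : ℕ → EuclideanSpace ℝ (Fin n) → ℝ := fun k => mollify (η k) V with hu
  set a : ℕ → EuclideanSpace ℝ (Fin n) → ℝ := fun k => mollify (η k) (fun y => |V y|)
  have hus : ∀ k, ContDiff ℝ ∞ (u k) := fun k => contDiff_mollify (hηs k) (hηc k) hVl
  have hWV : LocallyIntegrable (fun y => W y * V y) :=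
    (hVl.continuous_smul hW)
  have hlap : ∀ k x, ∑ i, pd i (pd i (u k)) x = mollify (η k) (fun y => W y * V y) x := by
    intro k x
    have e1 : ∀ i, pd i (pd i (u k)) x = mollify (pd i (pd i (η k))) V x := fun i => by
      rw [show pd i (u k) = mollify (pd i (η k)) V from
        funext fun x => pd_mollify (hηs k) (hηc k) hVl i x]
      exact pd_mollify (contDiff_pd (hηs k)) (hasCompactSupport_pd (hηc k)) hVl i x
    have e2 : ∀ f : EuclideanSpace ℝ (Fin n) → ℝ, Differentiable ℝ f → ∀ (i : Fin n) y,
        pd i (fun y => f (x - y)) y = -pd i f (x - y) := fun f hf i y => by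
      have h1 : HasFDerivAt (fun y : EuclideanSpace ℝ (Fin n) => x - y)
          (-ContinuousLinearMap.id ℝ (EuclideanSpace ℝ (Fin n))) y :=
        (hasFDerivAt_id y).const_sub x
      have h := (hf (x - y)).hasFDerivAt.comp y h1
      rw [pd, show (fun y => f (x - y)) = f ∘ fun y => x - y from rfl, h.fderiv]
      simp [pd]
    have e3 : ∀ (i : Fin n) y, pd i (pd i (fun y => η k (x - y))) y =
        pd i (pd i (η k)) (x - y) := fun i y => by
      rw [show pd i (fun y => η k (x - y)) = fun y => -pd i (η k) (x - y) from
        funext (e2 _ (differentiable_of_contDiff (hηs k)) i)]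
      have := e2 _ (differentiable_of_contDiff (contDiff_pd (i := i) (hηs k))) i y
      rw [pd, fderiv_fun_neg, neg_apply]
      change -pd i (fun y => pd i (η k) (x - y)) y = _
      rw [this, neg_neg]
    -- Testing the weak equation against the reflected kernel gives Δuₖ = ηₖ * (WV); the two sign
    -- changes of a second derivative cancel.
    have hψ := h (fun y => η k (x - y)) ((hηs k).comp (contDiff_const.sub contDiff_id))
      ((hηc k).comp_homeomorph (Homeomorph.subLeft x))
    simp_rw [e3, mul_sub, Finset.mul_sum] at hψ
    have i1 : ∀ i : Fin n, Integrable (fun y => V y * pd i (pd i (η k)) (x - y)) := fun i =>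
      integrable_mul_kernel (contDiff_pd (contDiff_pd (hηs k))).continuous
        (hasCompactSupport_pd (hasCompactSupport_pd (hηc k))) hVl x
    have e4 : ∀ y, V y * (W y * η k (x - y)) = W y * V y * η k (x - y) := fun y => by ring
    simp_rw [e4] at hψ
    rw [integral_sub (integrable_finsetSum _ fun i _ => i1 i)
      (integrable_mul_kernel (hηs k).continuous (hηc k) hWV x),
      integral_finsetSum _ fun i _ => i1 i, sub_eq_zero] at hψ
    rw [Finset.sum_congr rfl fun i _ => e1 i]
    exact hψ
  -- Moving W out of the mollification costs at most (ηₖ * |V|)/(k+1), and then W ≥ 1 is used.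
  have hcomm : ∀ k, ∀ x ∈ tsupport (χ k), u k x ^ 2 - 1 / (k + 1) * a k x ^ 2 ≤
      u k x * mollify (η k) (fun y => W y * V y) x := by
    intro k x hx
    have i1 := integrable_mul_kernel (hηs k).continuous (hηc k) hVl x
    have i2 := integrable_mul_kernel (hηs k).continuous (hηc k) hWV x
    have i3 := integrable_mul_kernel (hηs k).continuous (hηc k) hVal x
    have h1 : |mollify (η k) (fun y => W y * V y) x - W x * u k x| ≤ 1 / (k + 1) * a k x := by
      have e : mollify (η k) (fun y => W y * V y) x - W x * u k x =
          ∫ y, (W y * V y * η k (x - y) - W x * (V y * η k (x - y))) := by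
        rw [integral_sub i2 (i1.const_mul _), integral_const_mul]; rfl
      have e' : 1 / ((k : ℝ) + 1) * a k x = ∫ y, 1 / (k + 1) * (|V y| * η k (x - y)) := by
        rw [integral_const_mul]; rfl
      rw [e, e']
      refine abs_integral_le_integral_abs.trans
        (integral_mono (i2.sub (i1.const_mul _)).abs (i3.const_mul _) fun y => ?_)
      have e'' : W y * V y * η k (x - y) - W x * (V y * η k (x - y)) =
          (W y - W x) * (V y * η k (x - y)) := by ring
      simp only [e'']
      rw [abs_mul, abs_mul (V y), abs_of_nonneg (hη0 k (x - y)), abs_sub_comm]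
      by_cases hd : dist x y < δ k
      · exact mul_le_mul_of_nonneg_right (hδ k x hx y hd)
          (mul_nonneg (abs_nonneg _) (hη0 _ _))
      · rw [hηz k _ (by rw [← dist_eq_norm]; exact not_lt.1 hd)]
        simp
    have h2 : |u k x| ≤ a k x := abs_mollify_le (hη0 k) x
    have h3 : |u k x * (mollify (η k) (fun y => W y * V y) x - W x * u k x)| ≤
        a k x * (1 / (k + 1) * a k x) := by
      rw [abs_mul]
      exact mul_le_mul h2 h1 (abs_nonneg _) ((abs_nonneg _).trans h2)
    have h4 := neg_le_of_abs_le h3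
    nlinarith [mul_le_mul_of_nonneg_right (hW1 x) (sq_nonneg (u k x))]
  -- The Caccioppoli inequality contributes nC²/(k+1) through |∇χₖ|², the commutator error
  -- contributes 1/(k+1).
  have hest : ∀ k, ∫ x, χ k x ^ 2 * u k x ^ 2 ≤ (n * C ^ 2 + 1) / (k + 1) * (∫ x, V x ^ 2) := by
    intro k
    obtain ⟨c1, c2, c3, -, c5, -⟩ := hχ k
    obtain ⟨iu, ilu⟩ := integrable_mollify_sq (hηs k) (hηc k) (hη0 k) (hη1 k) hV
    obtain ⟨ia, ila⟩ := integrable_mollify_sq (hηs k) (hηc k) (hη0 k) (hη1 k) hVa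
    simp only [sq_abs] at ila
    have h1 := integral_sq_mul_laplacian_le (hus k) c1 c2
    have hk : (0 : ℝ) < k + 1 := by positivity
    have hgrad : ∀ x, (∑ i, pd i (χ k) x ^ 2) ≤ n * C ^ 2 / (k + 1) := fun x => by
      have : ∀ i ∈ Finset.univ, pd i (χ k) x ^ 2 ≤ C ^ 2 / (k + 1) := fun i _ => by
        rw [← sq_abs]
        refine (pow_le_pow_left₀ (abs_nonneg _) (c5 i x) 2).trans ?_
        rw [div_pow]
        exact div_le_div_of_nonneg_left (by positivity) hk (by nlinarith)
      refine (Finset.sum_le_card_nsmul _ _ _ this).trans_eq ?_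
      simp
      ring
    have h2 : ∫ x, (∑ i, pd i (χ k) x ^ 2) * u k x ^ 2 ≤
        n * C ^ 2 / (k + 1) * ∫ x, V x ^ 2 := by
      refine le_trans ?_ (mul_le_mul_of_nonneg_left ilu (by positivity))
      rw [← integral_const_mul]
      refine integral_mono_of_nonneg (Filter.Eventually.of_forall fun x => by positivity)
        (iu.const_mul _) (Filter.Eventually.of_forall fun x => ?_)
      exact mul_le_mul_of_nonneg_right (hgrad x) (sq_nonneg _)
    have hcs : HasCompactSupport (fun x => χ k x ^ 2) :=
      hasCompactSupport_of_zero c2 fun x hx => by simp [hx]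
    have hcu := (hus k).continuous
    have hcχ := c1.continuous
    have iL : Integrable (fun x => χ k x ^ 2 * (u k x * ∑ i, pd i (pd i (u k)) x)) :=
      Continuous.integrable_of_hasCompactSupport
        (ContDiff.continuous (𝕜 := ℝ) (n := ∞) (by have := hus k; fun_prop)) hcs.mul_right
    have i1 : Integrable (fun x => χ k x ^ 2 * u k x ^ 2) :=
      Continuous.integrable_of_hasCompactSupport (by fun_prop) hcs.mul_right
    have h3 : ∫ x, (χ k x ^ 2 * u k x ^ 2 - 1 / (k + 1) * a k x ^ 2) ≤
        ∫ x, χ k x ^ 2 * (u k x * ∑ i, pd i (pd i (u k)) x) := by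
      refine integral_mono (i1.sub (ia.const_mul _)) iL fun x => ?_
      simp only [hlap]
      by_cases hx : x ∈ tsupport (χ k)
      · have h4 := mul_le_mul_of_nonneg_left (hcomm k x hx) (sq_nonneg (χ k x))
        have h5 : χ k x ^ 2 ≤ 1 := pow_le_one₀ (c3 x).1 (c3 x).2
        have h6 : 0 ≤ 1 / ((k : ℝ) + 1) * a k x ^ 2 := by positivity
        nlinarith
      · rw [image_eq_zero_of_notMem_tsupport hx]
        have h6 : 0 ≤ 1 / ((k : ℝ) + 1) * a k x ^ 2 := by positivity
        simp only [ne_eq, OfNat.ofNat_ne_zero, not_false_eq_true, zero_pow, zero_mul, zero_sub]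
        linarith
    rw [integral_sub i1 (ia.const_mul _), integral_const_mul] at h3
    have h7 : 1 / ((k : ℝ) + 1) * (∫ x, mollify (η k) (fun y => |V y|) x ^ 2) ≤
        1 / (k + 1) * (∫ x, V x ^ 2) :=
      mul_le_mul_of_nonneg_left ila (by positivity)
    have h8 : (n * C ^ 2 + 1) / (k + 1) * (∫ x, V x ^ 2) =
        n * C ^ 2 / (k + 1) * (∫ x, V x ^ 2) + 1 / (k + 1) * (∫ x, V x ^ 2) := by ring
    linarith
  have hae : ∀ᵐ x, Filter.Tendsto (fun k => u k x) Filter.atTop (nhds (V x)) := by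
    have hφ0 : Filter.Tendsto (fun k => (φ k).rOut) Filter.atTop (nhds 0) :=
      squeeze_zero (fun k => (hδ0 k).le) hδ1 tendsto_one_div_add_atTop_nhds_zero_nat
    have := ContDiffBump.ae_convolution_tendsto_right_of_locallyIntegrable (μ := volume)
      (K := 2) hφ0 (Filter.Eventually.of_forall fun k => by
        change δ k ≤ 2 * (δ k / 2); linarith) hVl
    filter_upwards [this] with x hx
    refine hx.congr fun k => ?_
    rw [hu]
    simp only
    rw [← convolution_flip, convolution_def]
    simp [mollify, mul_comm, hη]
  have hlim : ∀ᵐ x, Filter.Tendsto (fun k => ENNReal.ofReal (χ k x ^ 2 * u k x ^ 2)) Filter.atTop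
      (nhds (ENNReal.ofReal (V x ^ 2))) := by
    filter_upwards [hae] with x hx
    refine (ENNReal.continuous_ofReal.tendsto _).comp ((hx.pow 2).congr' ?_)
    filter_upwards [Filter.eventually_ge_atTop ⌈‖x‖⌉₊] with k hk
    rw [(hχ k).2.2.2.1 x ((Nat.ceil_le.1 hk).trans (by linarith)), one_pow, one_mul]
  -- Fatou's lemma along uₖ → V almost everywhere.
  have hint : ∫⁻ x, ENNReal.ofReal (V x ^ 2) = 0 := by
    have hF := lintegral_liminf_le' (μ := volume) (u := Filter.atTop)
      (f := fun (k : ℕ) x => ENNReal.ofReal (χ k x ^ 2 * u k x ^ 2)) fun k => by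
        have h1 := (hχ k).1.continuous
        have h2 := (hus k).continuous
        exact (Measurable.ennreal_ofReal
          (Continuous.measurable (by fun_prop))).aemeasurable
    rw [lintegral_congr_ae (hlim.mono fun x hx => hx.liminf_eq)] at hF
    refine le_antisymm (hF.trans_eq (Filter.Tendsto.liminf_eq ?_)) zero_le
    have hz : Filter.Tendsto (fun k : ℕ => ENNReal.ofReal
        ((n * C ^ 2 + 1) / (k + 1) * ∫ x, V x ^ 2)) Filter.atTop (nhds 0) := by
      have : Filter.Tendsto (fun k : ℕ => (n * C ^ 2 + 1) * (1 / ((k : ℝ) + 1)) * ∫ x, V x ^ 2)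
          Filter.atTop (nhds ((n * C ^ 2 + 1) * 0 * ∫ x, V x ^ 2)) :=
        (tendsto_one_div_add_atTop_nhds_zero_nat.const_mul _).mul_const _
      rw [mul_zero, zero_mul] at this
      have := (ENNReal.continuous_ofReal.tendsto _).comp this
      rw [ENNReal.ofReal_zero] at this
      refine this.congr fun k => ?_
      simp only [Function.comp]
      congr 1
      ring
    refine tendsto_of_tendsto_of_tendsto_of_le_of_le tendsto_const_nhds hz
      (fun _ => zero_le) fun k => ?_
    rw [← ofReal_integral_eq_lintegral_ofReal]
    · exact ENNReal.ofReal_le_ofReal (hest k)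
    · have h1 := (hχ k).1.continuous
      have h2 := (hus k).continuous
      exact Continuous.integrable_of_hasCompactSupport (by fun_prop)
        (hasCompactSupport_of_zero (hχ k).2.1 fun x hx => by simp [hx])
    · exact Filter.Eventually.of_forall fun x => by positivity
  rw [lintegral_eq_zero_iff' (hV.integrable_sq.aemeasurable.ennreal_ofReal)] at hint
  filter_upwards [hint] with x hx
  have : V x ^ 2 ≤ 0 := by simpa using hx
  simpa using le_antisymm this (sq_nonneg _)

end Mollification

/-! ### Polynomial inequalities for the angular and radial coefficients. -/

section ScalarInequalities

theorem cubic_lower_bound {N s : ℝ} (hN : 5 ≤ N) (hs : 0 ≤ s) :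
    0 ≤ 3 + (2 * N + 5) * s - (24 * N + 8) * s ^ 2 + (4 * N ^ 2 + 16 * N + 4) * s ^ 3 := by
  obtain ⟨M, rfl⟩ : ∃ M, N = M + 5 := ⟨N - 5, by ring⟩
  have hM : 0 ≤ M := by linarith
  have h1 : 0 ≤ M * s * (28 * s ^ 2 - 21 / 2 * s + 1) := by
    have : 0 ≤ 28 * s ^ 2 - 21 / 2 * s + 1 := by nlinarith [sq_nonneg (s - 3 / 16)]
    positivity
  have h2 : 0 ≤ s * (2 * s * M - 3 / 4) ^ 2 := by positivity
  have h3 : 0 ≤ 3 + 231 / 16 * s - 128 * s ^ 2 + 184 * s ^ 3 := by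
    nlinarith [mul_nonneg hs (sq_nonneg (s - 2 / 5)), sq_nonneg (s - 2 / 5),
      mul_nonneg hs (sq_nonneg (s - 199 / 500)), sq_nonneg (s - 199 / 500)]
  -- The cubic equals 2·`h1` + `h2` + `h3` identically.
  nlinarith

/-- For n = 2 the cubic of `cubic_lower_bound` with N = 4 takes negative values near s = 9/20; the
constant is 3 + 4/5, where 4/5 is the slack left in `coefficient_angular`. -/
theorem cubic_lower_bound_two {s : ℝ} (hs : 0 ≤ s) :
    0 ≤ 19 / 5 + 13 * s - 104 * s ^ 2 + 132 * s ^ 3 := by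
  nlinarith [mul_nonneg hs (sq_nonneg (s - 2 / 5)), sq_nonneg (s - 2 / 5),
      mul_nonneg hs (sq_nonneg (s - 9 / 20)), sq_nonneg (s - 9 / 20)]

theorem cubic_lower_bound_radial {N s : ℝ} (hN : 4 ≤ N) (hs : 0 ≤ s) :
    0 ≤ 2 + (10 - 2 * N) * s + (4 * N ^ 2 - 12 * N - 16) * s ^ 2 + (8 * N + 8) * s ^ 3 := by
  obtain ⟨M, rfl⟩ : ∃ M, N = M + 4 := ⟨N - 4, by ring⟩
  have hM : 0 ≤ M := by linarith
  have h1 : 0 ≤ M * s ^ 2 := by positivity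
  have h2 : 0 ≤ M * s ^ 3 := by positivity
  have h3 : 0 ≤ s ^ 3 := by positivity
  -- Four times this square absorbs the only negative term, -2Ms.
  nlinarith [sq_nonneg (M * s - 1 / 4)]

/-- The angular coefficient. -/
theorem coefficient_angular {n : ℕ} (hn : 2 ≤ n) {s : ℝ} (hs : 0 ≤ s) :
    ((n : ℝ) - 1) / (n * (n + 3)) ≤
      s - 2 * ((1 + 2 * (n + 1) * s) / (2 * (n + 2))) ^ 2 * (1 - s) +
        1 / (n + 2) * ((1 - s - n * s) * (1 - 2 * s) + 4 * s * (1 - s) * (1 - 3 * s)) := by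
  have hn' : (2 : ℝ) ≤ n := by exact_mod_cast hn
  have hN : (0 : ℝ) < n + 2 := by linarith
  have key : s - 2 * ((1 + 2 * (n + 1) * s) / (2 * (n + 2))) ^ 2 * (1 - s) +
        1 / (n + 2) * ((1 - s - n * s) * (1 - 2 * s) + 4 * s * (1 - s) * (1 - 3 * s)) =
      (2 * n + (3 + (2 * (n + 2) + 5) * s - (24 * (n + 2) + 8) * s ^ 2 +
        (4 * ((n : ℝ) + 2) ^ 2 + 16 * (n + 2) + 4) * s ^ 3)) / (2 * (n + 2) ^ 2) := by
    field_simp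
    ring
  rw [key, div_le_div_iff₀ (by positivity) (by positivity)]
  -- Since n²(n+3) - (n-1)(n+2)² = 4, the constant c is below n/(n+2)², so nonnegativity of the
  -- cubic suffices. It holds for n ≥ 3; for n = 2 the slack is needed.
  rcases hn.eq_or_lt with rfl | h3
  · push_cast
    nlinarith [cubic_lower_bound_two hs]
  · have h3' : (3 : ℝ) ≤ n := by exact_mod_cast h3
    have h := cubic_lower_bound (N := n + 2) (by linarith) hs
    have h4 := mul_nonneg h (show (0 : ℝ) ≤ n * (n + 3) by positivity)
    nlinarith

/-- The radial coefficient. -/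
theorem coefficient_radial {n : ℕ} (hn : 2 ≤ n) {s : ℝ} (hs : 0 ≤ s) :
    ((n : ℝ) - 1) / (n * (n + 3)) ≤
      s - 2 * ((1 + 2 * (n + 1) * s) / (2 * (n + 2))) ^ 2 * (1 - s) +
        1 / (n + 2) * ((1 - s - n * s) * (1 - 2 * s) + 4 * s * (1 - s) * (1 - 3 * s)) +
      (1 - s) * (4 * s ^ 2 - 2 * ((1 + 2 * (n + 1) * s) / (2 * (n + 2))) ^ 2) := by
  have hn' : (2 : ℝ) ≤ n := by exact_mod_cast hn
  have key : s - 2 * ((1 + 2 * (n + 1) * s) / (2 * (n + 2))) ^ 2 * (1 - s) +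
        1 / (n + 2) * ((1 - s - n * s) * (1 - 2 * s) + 4 * s * (1 - s) * (1 - 3 * s)) +
      (1 - s) * (4 * s ^ 2 - 2 * ((1 + 2 * (n + 1) * s) / (2 * (n + 2))) ^ 2) =
      (2 * n + (2 + (10 - 2 * (n + 2)) * s + (4 * (n + 2) ^ 2 - 12 * (n + 2) - 16) * s ^ 2 +
        (8 * (n + 2) + 8) * s ^ 3)) / (2 * ((n : ℝ) + 2) ^ 2) := by
    field_simp
    ring
  rw [key, div_le_div_iff₀ (by positivity) (by positivity)]
  have h := cubic_lower_bound_radial (N := n + 2) (by linarith) hs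
  have h4 := mul_nonneg h (show (0 : ℝ) ≤ n * (n + 3) by positivity)
  nlinarith

end ScalarInequalities

/-! ### The weight σ² and its derivatives. -/

section Weight

variable {n : ℕ} {x : EuclideanSpace ℝ (Fin n)}

theorem sigmaSq_pos : 0 < sigmaSq n x := by unfold sigmaSq; positivity

theorem sigmaSq_mul : sigmaSq n x * ‖x‖ ^ 2 = 1 - sigmaSq n x := by
  unfold sigmaSq
  have : (1 : ℝ) + ‖x‖ ^ 2 ≠ 0 := by positivity
  field_simp
  ring

theorem sigmaSq_le_one : sigmaSq n x ≤ 1 := by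
  have := mul_nonneg (sigmaSq_pos (x := x)).le (sq_nonneg ‖x‖)
  rw [sigmaSq_mul] at this
  linarith

@[fun_prop]
theorem contDiff_sigmaSq : ContDiff ℝ ∞ (sigmaSq n) := by
  unfold sigmaSq
  have := contDiff_norm_sq' (n := n)
  exact contDiff_const.div (contDiff_const.add this) fun x => by positivity

theorem pd_sigmaSq (i : Fin n) : pd i (sigmaSq n) x = -2 * x i * sigmaSq n x ^ 2 := by
  have h1 : HasDerivAt (fun t : ℝ => 1 / (1 + t)) (-1 / (1 + ‖x‖ ^ 2) ^ 2) (‖x‖ ^ 2) := by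
    have := ((hasDerivAt_id (‖x‖ ^ 2)).const_add 1).fun_inv
      (show 1 + id (‖x‖ ^ 2) ≠ 0 by simp only [id]; positivity)
    simpa using this
  have := pd_comp (i := i) (f := fun y : EuclideanSpace ℝ (Fin n) => ‖y‖ ^ 2) h1
    (differentiable_of_contDiff contDiff_norm_sq' x)
  change pd i (sigmaSq n) x = _ at this
  rw [this, pd_norm_sq, sigmaSq, div_pow, one_pow]
  ring

end Weight

/-! ### The Bochner formula for vector fields. -/

section Bochner

variable {n : ℕ}

/-- Bochner formula: the square of the Gaussian divergence of a vector field. -/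
theorem integral_sq_sum_pdAdj {F : Fin n → EuclideanSpace ℝ (Fin n) → ℝ}
    (hF : ∀ i, ContDiff ℝ ∞ (F i)) (hc : ∀ i, HasCompactSupport (F i)) :
    ∫ x, (∑ i, pdAdj i (F i) x) ^ 2 ∂gaussian n =
      ∫ x, (∑ i, F i x ^ 2 + ∑ i, ∑ j, pd j (F i) x * pd i (F j) x) ∂gaussian n := by
  have hF' : ∀ i, Continuous (F i) := fun i => (hF i).continuous
  have hpc : ∀ i j, HasCompactSupport (pd i (F j)) := fun i j => hasCompactSupport_pd (hc j)
  have hac : ∀ i, HasCompactSupport (pdAdj i (F i)) := fun i =>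
    HasCompactSupport.sub (f := fun x => x i * F i x) (hc i).mul_left (hpc i i)
  have i1 : ∀ i j, Integrable (fun x => pdAdj j (F j) x * pdAdj i (F i) x) (gaussian n) :=
    fun i j => integrable_of_hasCompactSupport
      ((contDiff_pdAdj (hF j)).mul (contDiff_pdAdj (hF i))).continuous (hac i).mul_left
  have i2 : ∀ i, Integrable (fun x => F i x ^ 2) (gaussian n) := fun i =>
    integrable_of_hasCompactSupport (by fun_prop)
      (hasCompactSupport_of_zero (hc i) fun x hx => by simp [hx])
  have i3 : ∀ i j, Integrable (fun x => pd j (F i) x * pd i (F j) x) (gaussian n) :=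
    fun i j => integrable_of_hasCompactSupport
      ((contDiff_pd (hF i)).mul (contDiff_pd (hF j))).continuous (hpc i j).mul_left
  have i4 : ∀ i j, Integrable (fun x => F j x * F i x) (gaussian n) := fun i j =>
    integrable_of_hasCompactSupport (by fun_prop) (hc i).mul_left
  have e : ∀ i j, ∫ x, pdAdj j (F j) x * pdAdj i (F i) x ∂gaussian n =
      (if i = j then ∫ x, F i x ^ 2 ∂gaussian n else 0) +
        ∫ x, pd j (F i) x * pd i (F j) x ∂gaussian n := fun i j => by
    rw [integral_mul_pdAdj i (contDiff_pdAdj (hF j)) (hF i) (hc i)]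
    simp_rw [pd_pdAdj i j (hF j), add_mul]
    have i5 : Integrable (fun x => pdAdj j (pd i (F j)) x * F i x) (gaussian n) :=
      integrable_of_hasCompactSupport
        ((contDiff_pdAdj (contDiff_pd (hF j))).mul (hF i)).continuous (hc i).mul_left
    have e1 : ∫ x, pdAdj j (pd i (F j)) x * F i x ∂gaussian n =
        ∫ x, pd j (F i) x * pd i (F j) x ∂gaussian n := by
      simp_rw [mul_comm _ (F i _)]
      exact integral_mul_pdAdj j (hF i) (contDiff_pd (hF j)) (hpc i j)
    by_cases hij : i = j
    · subst hij
      simp only [if_true, sq]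
      rw [integral_add (i4 i i) i5, e1]
    · simp only [hij, if_false, zero_mul, zero_add]
      exact e1
  simp_rw [sq (∑ i, pdAdj i (F i) _), Finset.sum_mul_sum]
  rw [integral_finsetSum _ fun i _ => integrable_finsetSum _ fun j _ => i1 j i]
  simp_rw [integral_finsetSum _ fun j _ => i1 j _, e]
  rw [integral_add (integrable_finsetSum _ fun i _ => i2 i)
    (integrable_finsetSum _ fun i _ => integrable_finsetSum _ fun j _ => i3 i j),
    integral_finsetSum _ fun i _ => i2 i,
    integral_finsetSum _ fun i _ => integrable_finsetSum _ fun j _ => i3 i j]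
  simp_rw [integral_finsetSum _ fun j _ => i3 _ j, Finset.sum_add_distrib]
  simp
  rw [Finset.sum_comm]

end Bochner

/-! ### Algebra of the Hessian terms. -/

section FiniteSums

variable {n : ℕ} (x p : Fin n → ℝ) (S : Fin n → Fin n → ℝ)

/-- With p = ∇u and S = ∇²u this is Σ ∂ⱼFᵢ ∂ᵢFⱼ for the field F = σ²∇u, because ∂ⱼσ² = -2xⱼσ⁴. -/
theorem sum_twisted_eq (hS : ∀ i j, S i j = S j i) (s : ℝ) :
    ∑ i, ∑ j, (s * S i j - 2 * s ^ 2 * x j * p i) * (s * S j i - 2 * s ^ 2 * x i * p j) =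
      s ^ 2 * (∑ i, ∑ j, S i j ^ 2) - 4 * s ^ 3 * (∑ i, ∑ j, x i * S i j * p j) +
        4 * s ^ 4 * (∑ i, x i * p i) ^ 2 := by
  have h1 : ∑ i, ∑ j, x i * S i j * p j = ∑ i, ∑ j, x j * S i j * p i := by
    rw [Finset.sum_comm]
    exact Finset.sum_congr rfl fun i _ => Finset.sum_congr rfl fun j _ => by rw [hS]
  have h2 : 4 * s ^ 3 * (∑ i, ∑ j, x i * S i j * p j) =
      2 * s ^ 3 * (∑ i, ∑ j, x i * S i j * p j) + 2 * s ^ 3 * (∑ i, ∑ j, x j * S i j * p i) := by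
    rw [← h1]; ring
  rw [h2, sq (∑ i, x i * p i), Finset.sum_mul_sum]
  simp only [Finset.mul_sum, ← Finset.sum_add_distrib, ← Finset.sum_sub_distrib]
  refine Finset.sum_congr rfl fun i _ => Finset.sum_congr rfl fun j _ => ?_
  rw [hS j i]
  ring

/-- Expand |S - α(x⊗p + p⊗x)|² ≥ 0. The free α lets the mixed term x·Sp be matched later. -/
theorem sum_sq_ge (hS : ∀ i j, S i j = S j i) (α : ℝ) :
    4 * α * (∑ i, ∑ j, x i * S i j * p j) -
      2 * α ^ 2 * ((∑ i, x i ^ 2) * (∑ i, p i ^ 2) + (∑ i, x i * p i) ^ 2) ≤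
        ∑ i, ∑ j, S i j ^ 2 := by
  have h0 : 0 ≤ ∑ i, ∑ j, (S i j - α * (x i * p j + p i * x j)) ^ 2 := by positivity
  have h1 : ∑ i, ∑ j, x i * S i j * p j = ∑ i, ∑ j, x j * S i j * p i := by
    rw [Finset.sum_comm]
    exact Finset.sum_congr rfl fun i _ => Finset.sum_congr rfl fun j _ => by rw [hS]
  have h2 : 4 * α * (∑ i, ∑ j, x i * S i j * p j) =
      2 * α * (∑ i, ∑ j, x i * S i j * p j) + 2 * α * (∑ i, ∑ j, x j * S i j * p i) := by
    rw [← h1]; ring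
  have h3 : ∑ i, ∑ j, x i ^ 2 * p j ^ 2 = ∑ i, ∑ j, x j ^ 2 * p i ^ 2 := Finset.sum_comm
  have h4 : 2 * α ^ 2 * ((∑ i, x i ^ 2) * (∑ i, p i ^ 2)) =
      α ^ 2 * (∑ i, ∑ j, x i ^ 2 * p j ^ 2) + α ^ 2 * (∑ i, ∑ j, x j ^ 2 * p i ^ 2) := by
    rw [← h3, Finset.sum_mul_sum]; ring
  have h5 : ∑ i, ∑ j, S i j ^ 2 - ∑ i, ∑ j, (S i j - α * (x i * p j + p i * x j)) ^ 2 =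
      4 * α * (∑ i, ∑ j, x i * S i j * p j) -
      2 * α ^ 2 * ((∑ i, x i ^ 2) * (∑ i, p i ^ 2) + (∑ i, x i * p i) ^ 2) := by
    rw [h2, mul_add, h4, sq (∑ i, x i * p i), Finset.sum_mul_sum]
    simp only [Finset.mul_sum, ← Finset.sum_add_distrib, ← Finset.sum_sub_distrib]
    refine Finset.sum_congr rfl fun i _ => Finset.sum_congr rfl fun j _ => ?_
    ring
  linarith

end FiniteSums

/-! ### The pointwise form of the gap inequality. -/

section Pointwise

/-- The pointwise inequality behind the spectral gap estimate: `q = |∇u|²`, `X = (x · ∇u)²`,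
`Y = x · ∇²u ∇u`, `Q = |∇²u|²` and `t = |x|²`. -/
theorem pointwise_bochner {n : ℕ} (hn : 2 ≤ n) {s t q X Y Q : ℝ} (hs : 0 < s) (hst : s * t = 1 - s)
    (hq : 0 ≤ q) (hX : 0 ≤ X) (hXq : X ≤ t * q)
    (hQ : ∀ α : ℝ, 4 * α * Y - 2 * α ^ 2 * (t * q + X) ≤ Q) :
    ((n : ℝ) - 1) / (n * (n + 3)) * (s * q) +
        1 / (n + 2) * ((s ^ 2 * (1 - 2 * s)) * (2 * Y) + (n - t) * (s ^ 2 * (1 - 2 * s)) * q -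
          4 * t * s ^ 3 * (1 - 3 * s) * q) ≤
      s ^ 2 * q + (s ^ 2 * Q - 4 * s ^ 3 * Y + 4 * s ^ 4 * X) := by
  -- This is b/2 + (1-b)s with b = 1/(n+2), the value for which the terms in Y cancel: 4α - 4s -
  -- 2b(1-2s) = 0.
  set α : ℝ := (1 + 2 * (n + 1) * s) / (2 * (n + 2)) with hα
  set b : ℝ := 1 / (n + 2) with hb
  have hαb : α = b / 2 + (1 - b) * s := by
    rw [hα, hb]; field_simp; ring
  have h1 := mul_le_mul_of_nonneg_left (hQ α) (sq_nonneg s)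
  set c : ℝ := ((n : ℝ) - 1) / (n * (n + 3)) with hc
  have hang := coefficient_angular hn hs.le
  have hrad := coefficient_radial hn hs.le
  rw [← hα, ← hb, ← hc] at hang hrad
  set P : ℝ := s - 2 * α ^ 2 * (1 - s) +
    b * ((1 - s - n * s) * (1 - 2 * s) + 4 * s * (1 - s) * (1 - 3 * s)) - c with hP
  have hP0 : 0 ≤ P := by linarith
  have hR0 : 0 ≤ P + (1 - s) * (4 * s ^ 2 - 2 * α ^ 2) := by linarith
  -- the reduced form
  have hred : 0 ≤ P * q + s * (4 * s ^ 2 - 2 * α ^ 2) * X := by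
    -- The expression is affine in X ∈ [0, tq], so only the ends matter: X = 0 is the angular
    -- coefficient and X = tq, through st = 1 - s, the radial one.
    rcases le_total 0 (4 * s ^ 2 - 2 * α ^ 2) with h | h
    · positivity
    · have h2 : s * (4 * s ^ 2 - 2 * α ^ 2) * (t * q) ≤ s * (4 * s ^ 2 - 2 * α ^ 2) * X :=
        mul_le_mul_of_nonpos_left hXq (mul_nonpos_of_nonneg_of_nonpos hs.le h)
      have h3 : s * (4 * s ^ 2 - 2 * α ^ 2) * (t * q) = (s * t) * (4 * s ^ 2 - 2 * α ^ 2) * q := by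
        ring
      rw [h3, hst] at h2
      have h4 := mul_nonneg hR0 hq
      linarith
  have hts : t = 1 / s - 1 := by field_simp; linarith
  have e : s ^ 2 * q + (s ^ 2 * (4 * α * Y - 2 * α ^ 2 * (t * q + X)) - 4 * s ^ 3 * Y +
      4 * s ^ 4 * X) - (c * (s * q) +
        b * ((s ^ 2 * (1 - 2 * s)) * (2 * Y) + (n - t) * (s ^ 2 * (1 - 2 * s)) * q -
          4 * t * s ^ 3 * (1 - 3 * s) * q)) =
      s * (P * q + s * (4 * s ^ 2 - 2 * α ^ 2) * X) := by
    have e1 : 4 * α * Y = 2 * b * Y + 4 * (1 - b) * s * Y := by rw [hαb]; ring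
    rw [e1, hP, hts]
    field_simp
    ring
  have := mul_nonneg hs.le hred
  linarith

end Pointwise

/-! ### The inequality c⟨A u, u⟩ ≤ ‖A u‖² on test functions. -/

section GapInequality

variable {n : ℕ}

theorem generator_eq_neg_sum_pdAdj {u : EuclideanSpace ℝ (Fin n) → ℝ} (hu : ContDiff ℝ ∞ u)
    (x : EuclideanSpace ℝ (Fin n)) :
    generator (sigmaSq n) u x = -∑ i, pdAdj i (fun y => sigmaSq n y * pd i u y) x := by
  rw [generator_eq_sum contDiff_sigmaSq hu, ← Finset.sum_neg_distrib]
  refine Finset.sum_congr rfl fun i _ => ?_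
  rw [pdAdj]
  ring

/-- Symmetry of the diffusion operator on test functions. -/
theorem integral_generator_mul {u v : EuclideanSpace ℝ (Fin n) → ℝ} (hu : ContDiff ℝ ∞ u)
    (huc : HasCompactSupport u) (hv : ContDiff ℝ ∞ v) :
    ∫ x, v x * generator (sigmaSq n) u x ∂gaussian n =
      -∫ x, sigmaSq n x * ∑ i, pd i u x * pd i v x ∂gaussian n := by
  have hF : ∀ i, ContDiff ℝ ∞ (fun y => sigmaSq n y * pd i u y) := fun i => by fun_prop
  have hFc : ∀ i, HasCompactSupport (fun y => sigmaSq n y * pd i u y) := fun i =>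
    (hasCompactSupport_pd huc).mul_left
  have hac : ∀ i, HasCompactSupport (pdAdj i (fun y => sigmaSq n y * pd i u y)) := fun i =>
    HasCompactSupport.sub (f := fun x => x i * (sigmaSq n x * pd i u x)) (hFc i).mul_left
      (hasCompactSupport_pd (hFc i))
  simp_rw [generator_eq_neg_sum_pdAdj hu, mul_neg, Finset.mul_sum]
  rw [integral_neg, integral_finsetSum _ fun i _ => integrable_of_hasCompactSupport
      (hv.mul (contDiff_pdAdj (hF i))).continuous (hac i).mul_left,
    integral_finsetSum _ fun i _ => integrable_of_hasCompactSupport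
      (ContDiff.continuous (𝕜 := ℝ) (n := ∞) (by fun_prop))
      (hasCompactSupport_of_zero (hasCompactSupport_pd (i := i) huc) fun x hx => by simp [hx])]
  congr 1
  refine Finset.sum_congr rfl fun i _ => ?_
  rw [integral_mul_pdAdj i hv (hF i) (hFc i)]
  refine integral_congr_ae (Filter.Eventually.of_forall fun x => ?_)
  simp only
  ring

/-- Integration by parts of the cross term. -/
theorem integral_radial_eq_zero {q : EuclideanSpace ℝ (Fin n) → ℝ} (hq : ContDiff ℝ ∞ q)
    (hc : HasCompactSupport q) :
    ∫ x, ((sigmaSq n x ^ 2 * (1 - 2 * sigmaSq n x)) * (∑ i, x i * pd i q x) +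
      (n - ‖x‖ ^ 2) * (sigmaSq n x ^ 2 * (1 - 2 * sigmaSq n x)) * q x -
        4 * ‖x‖ ^ 2 * sigmaSq n x ^ 3 * (1 - 3 * sigmaSq n x) * q x) ∂gaussian n = 0 := by
  -- The integrand is the Gaussian divergence ρ⁻¹ div(ρ g q x) of a compactly supported field.
  set g : EuclideanSpace ℝ (Fin n) → ℝ := fun x => sigmaSq n x ^ 2 * (1 - 2 * sigmaSq n x) with hg
  have hgs : ContDiff ℝ ∞ g := by fun_prop
  have hpg : ∀ i x, pd i g x = -4 * x i * (sigmaSq n x ^ 3 * (1 - 3 * sigmaSq n x)) := fun i x => by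
    have h1 : HasDerivAt (fun s : ℝ => s ^ 2 * (1 - 2 * s))
        (2 * sigmaSq n x * (1 - 2 * sigmaSq n x) + sigmaSq n x ^ 2 * (-2)) (sigmaSq n x) := by
      have := (hasDerivAt_pow 2 (sigmaSq n x)).fun_mul
        (((hasDerivAt_id (sigmaSq n x)).const_mul 2).const_sub 1)
      simpa using this
    have := pd_comp (i := i) h1 (differentiable_of_contDiff contDiff_sigmaSq x)
    change pd i g x = _ at this
    rw [this, pd_sigmaSq]
    ring
  have hs : ∀ i, ContDiff ℝ ∞ (fun y : EuclideanSpace ℝ (Fin n) => g y * (y i * q y)) :=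
    fun i => by fun_prop
  have hcs : ∀ i, HasCompactSupport (fun y : EuclideanSpace ℝ (Fin n) => g y * (y i * q y)) :=
    fun i => hasCompactSupport_of_zero hc fun x hx => by simp [hx]
  have h0 : ∀ i, ∫ x, (pd i (fun y => g y * (y i * q y)) x -
      x i * (g x * (x i * q x))) ∂gaussian n = 0 := fun i => by
    rw [integral_sub, integral_pd_gaussian_of_hasCompactSupport i (hs i) (hcs i), sub_self]
    · exact integrable_of_hasCompactSupport (contDiff_pd (hs i)).continuous
        (hasCompactSupport_pd (hcs i))
    · exact integrable_of_hasCompactSupport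
        ((contDiff_coord i).mul (hs i)).continuous (hcs i).mul_left
  have h1 : ∀ i, Integrable (fun x => pd i (fun y => g y * (y i * q y)) x -
      x i * (g x * (x i * q x))) (gaussian n) := fun i =>
    integrable_of_hasCompactSupport
      ((contDiff_pd (hs i)).sub ((contDiff_coord i).mul (hs i))).continuous
      ((hasCompactSupport_pd (hcs i)).sub (hcs i).mul_left)
  have h2 := integral_finsetSum Finset.univ fun i _ => h1 i
  simp_rw [h0] at h2
  rw [Finset.sum_const_zero] at h2
  rw [← h2]
  refine integral_congr_ae (Filter.Eventually.of_forall fun x => ?_)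
  have h3 : ∀ i, pd i (fun y => g y * (y i * q y)) x - x i * (g x * (x i * q x)) =
      g x * (x i * pd i q x) + g x * q x - (x i * x i) * (g x * q x) -
        (x i * x i) * (4 * (sigmaSq n x ^ 3 * (1 - 3 * sigmaSq n x)) * q x) := fun i => by
    have d1 := differentiable_of_contDiff hgs x
    have d2 := differentiable_of_contDiff (contDiff_coord i) x
    have d3 := differentiable_of_contDiff hq x
    rw [pd_mul d1 (d2.fun_mul d3), pd_mul d2 d3, pd_coord, hpg, if_pos rfl]
    ring
  simp_rw [h3]
  have h4 : ∀ A B D : ℝ, ∑ i, (g x * (x i * pd i q x) + A - (x i * x i) * B - (x i * x i) * D) =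
      g x * ∑ i, x i * pd i q x + n * A - ‖x‖ ^ 2 * B - ‖x‖ ^ 2 * D := fun A B D => by
    rw [Finset.sum_sub_distrib, Finset.sum_sub_distrib, Finset.sum_add_distrib, ← Finset.sum_mul,
      ← Finset.sum_mul, sum_coord_sq, ← Finset.mul_sum, Finset.sum_const, Finset.card_univ,
      Fintype.card_fin, nsmul_eq_mul]
  rw [h4]
  simp only [hg]
  ring

/-- The integrated Bakry–Émery type inequality for the weighted operator. -/
theorem gap_inequality (hn : 2 ≤ n) {u : EuclideanSpace ℝ (Fin n) → ℝ} (hu : ContDiff ℝ ∞ u)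
    (huc : HasCompactSupport u) :
    ((n : ℝ) - 1) / (n * (n + 3)) * ∫ x, sigmaSq n x * ∑ i, pd i u x * pd i u x ∂gaussian n ≤
      ∫ x, generator (sigmaSq n) u x ^ 2 ∂gaussian n := by
  have hF : ∀ i, ContDiff ℝ ∞ (fun y => sigmaSq n y * pd i u y) := fun i => by fun_prop
  have hpc : ∀ i, HasCompactSupport (pd i u) := fun i => hasCompactSupport_pd huc
  have hFc : ∀ i, HasCompactSupport (fun y => sigmaSq n y * pd i u y) := fun i => (hpc i).mul_left
  set q : EuclideanSpace ℝ (Fin n) → ℝ := fun x => ∑ i, pd i u x * pd i u x with hq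
  have hqs : ContDiff ℝ ∞ q := by fun_prop
  have huz : ∀ x, x ∉ tsupport u → ∀ i, pd i u x = 0 := fun x hx i => by
    rw [pd, fderiv_of_notMem_tsupport ℝ hx]; rfl
  have hqc : HasCompactSupport q := HasCompactSupport.intro huc.isCompact fun x hx => by
    simp [hq, huz x hx]
  have hpq : ∀ i x, pd i q x = ∑ j, 2 * (pd i (pd j u) x * pd j u x) := fun i x => by
    have d : ∀ j, DifferentiableAt ℝ (pd j u) x := fun j =>
      differentiable_of_contDiff (contDiff_pd hu) x
    rw [hq, pd_sum _ fun j _ => (d j).fun_mul (d j)]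
    refine Finset.sum_congr rfl fun j _ => ?_
    rw [pd_mul (d j) (d j)]
    ring
  have hZ := integral_radial_eq_zero hqs hqc
  have hpF : ∀ i j x, pd j (fun y => sigmaSq n y * pd i u y) x =
      sigmaSq n x * pd i (pd j u) x - 2 * sigmaSq n x ^ 2 * x j * pd i u x := fun i j x => by
    rw [pd_mul (differentiable_of_contDiff contDiff_sigmaSq x)
      (differentiable_of_contDiff (contDiff_pd hu) x), pd_sigmaSq, pd_comm hu]
    ring
  simp_rw [generator_eq_neg_sum_pdAdj hu, neg_sq]
  rw [integral_sq_sum_pdAdj hF hFc, ← integral_const_mul]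
  set Z : EuclideanSpace ℝ (Fin n) → ℝ := fun x =>
    ((sigmaSq n x ^ 2 * (1 - 2 * sigmaSq n x)) * (∑ i, x i * pd i q x) +
      (n - ‖x‖ ^ 2) * (sigmaSq n x ^ 2 * (1 - 2 * sigmaSq n x)) * q x -
        4 * ‖x‖ ^ 2 * sigmaSq n x ^ 3 * (1 - 3 * sigmaSq n x) * q x) with hZd
  have hns := contDiff_norm_sq' (n := n)
  have iZ : Integrable Z (gaussian n) := by
    refine integrable_of_hasCompactSupport
      (ContDiff.continuous (𝕜 := ℝ) (n := ∞) (by fun_prop)) ?_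
    refine HasCompactSupport.intro hqc.isCompact fun x hx => ?_
    have h1 : ∀ i, pd i q x = 0 := fun i => by rw [pd, fderiv_of_notMem_tsupport ℝ hx]; rfl
    simp [hZd, h1, image_eq_zero_of_notMem_tsupport hx]
  have i1 : Integrable (fun x => ((n : ℝ) - 1) / (n * (n + 3)) * (sigmaSq n x * q x))
      (gaussian n) :=
    integrable_of_hasCompactSupport (ContDiff.continuous (𝕜 := ℝ) (n := ∞) (by fun_prop))
      (hasCompactSupport_of_zero hqc fun x hx => by simp [hx])
  have i2 : Integrable (fun x => (∑ i, (sigmaSq n x * pd i u x) ^ 2 + ∑ i, ∑ j,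
      pd j (fun y => sigmaSq n y * pd i u y) x * pd i (fun y => sigmaSq n y * pd j u y) x))
      (gaussian n) := by
    refine integrable_of_hasCompactSupport
      (ContDiff.continuous (𝕜 := ℝ) (n := ∞) (by fun_prop)) ?_
    refine HasCompactSupport.intro huc.isCompact fun x hx => ?_
    have h2 : ∀ i, x ∉ tsupport (pd i u) := fun i h =>
      hx (tsupport_fderiv_apply_subset ℝ _ h)
    have h3 : ∀ i j, pd j (pd i u) x = 0 := fun i j => by
      rw [pd, fderiv_of_notMem_tsupport ℝ (h2 i)]; rfl
    simp [hpF, h3, huz x hx]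
  -- Z integrates to zero, so adding it changes nothing after integration but makes the comparison
  -- hold pointwise.
  have hle : ∫ x, (((n : ℝ) - 1) / (n * (n + 3)) * (sigmaSq n x * q x) + 1 / (n + 2) * Z x)
      ∂gaussian n ≤ ∫ x, (∑ i, (sigmaSq n x * pd i u x) ^ 2 + ∑ i, ∑ j,
      pd j (fun y => sigmaSq n y * pd i u y) x * pd i (fun y => sigmaSq n y * pd j u y) x)
      ∂gaussian n := by
    refine integral_mono (i1.add (iZ.const_mul _)) i2 fun x => ?_
    have hS : ∀ i j, pd i (pd j u) x = pd j (pd i u) x := fun i j => pd_comm hu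
    have e1 := sum_twisted_eq (fun i => x i) (fun i => pd i u x)
      (fun i j => pd i (pd j u) x) hS (sigmaSq n x)
    have hsq : ∑ i, pd i u x ^ 2 = q x := by simp [hq, sq]
    have hxs : ∑ i, x i ^ 2 = ‖x‖ ^ 2 := (EuclideanSpace.real_norm_sq_eq x).symm
    have hY : ∑ i, x i * pd i q x = 2 * ∑ i, ∑ j, x i * pd i (pd j u) x * pd j u x := by
      simp_rw [hpq, Finset.mul_sum]
      refine Finset.sum_congr rfl fun i _ => Finset.sum_congr rfl fun j _ => ?_
      ring
    have hCS : (∑ i, x i * pd i u x) ^ 2 ≤ ‖x‖ ^ 2 * q x := by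
      rw [← hsq, ← hxs]
      exact Finset.sum_mul_sq_le_sq_mul_sq _ _ _
    have := pointwise_bochner hn (sigmaSq_pos (x := x)) sigmaSq_mul
      (q := q x) (by rw [← hsq]; positivity) (sq_nonneg _) hCS
      (Y := ∑ i, ∑ j, x i * pd i (pd j u) x * pd j u x)
      (Q := ∑ i, ∑ j, pd i (pd j u) x ^ 2) fun α => by
        have := sum_sq_ge (fun i => x i) (fun i => pd i u x) (fun i j => pd i (pd j u) x) hS α
        rwa [hsq, hxs] at this
    simp only [hpF, e1, mul_pow, ← Finset.mul_sum, hsq, hZd, hY]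
    exact this
  rw [integral_add i1 (iZ.const_mul _), integral_const_mul (1 / ((n : ℝ) + 2)), hZ, mul_zero,
    add_zero] at hle
  exact hle

end GapInequality

/-! ### Reduction of essential self-adjointness to a Schrödinger operator. -/

section EssentialSelfAdjointness

variable {n : ℕ}

/-- The positive function conjugating the weighted operator to a Schrödinger operator. -/
def groundState (n : ℕ) (x : EuclideanSpace ℝ (Fin n)) : ℝ :=
  Real.exp (1 / 2 * Real.log (1 + ‖x‖ ^ 2) + ‖x‖ ^ 2 / 4)

theorem groundState_pos (x : EuclideanSpace ℝ (Fin n)) : 0 < groundState n x := Real.exp_pos _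

@[fun_prop]
theorem contDiff_groundState : ContDiff ℝ ∞ (groundState n) := by
  unfold groundState
  have h := contDiff_norm_sq' (n := n)
  have h2 : ContDiff ℝ ∞ (fun x : EuclideanSpace ℝ (Fin n) => Real.log (1 + ‖x‖ ^ 2)) :=
    (contDiff_const.add h).log fun x => by positivity
  fun_prop

/-- Up to a constant this is 1/(σ²ρ), the choice for which conjugation removes the first-order term.
-/
theorem groundState_sq (x : EuclideanSpace ℝ (Fin n)) :
    groundState n x ^ 2 = (1 + ‖x‖ ^ 2) * Real.exp (‖x‖ ^ 2 / 2) := by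
  rw [groundState, ← Real.exp_nat_mul, ← Real.exp_log (show 0 < 1 + ‖x‖ ^ 2 by positivity),
    ← Real.exp_add, Real.exp_log (by positivity)]
  congr 1
  push_cast
  ring

theorem pd_groundState (i : Fin n) (x : EuclideanSpace ℝ (Fin n)) :
    pd i (groundState n) x = x i * (sigmaSq n x + 1 / 2) * groundState n x := by
  have h1 : HasDerivAt (fun t : ℝ => Real.exp (1 / 2 * Real.log (1 + t) + t / 4))
      (Real.exp (1 / 2 * Real.log (1 + ‖x‖ ^ 2) + ‖x‖ ^ 2 / 4) *
        (1 / 2 * (1 / (1 + ‖x‖ ^ 2)) + 1 / 4)) (‖x‖ ^ 2) :=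
    (((((hasDerivAt_id (‖x‖ ^ 2)).const_add 1).log
      (show 1 + id (‖x‖ ^ 2) ≠ 0 by simp only [id]; positivity)).const_mul (1 / 2)).add
        ((hasDerivAt_id (‖x‖ ^ 2)).div_const 4)).exp
  have := pd_comp (i := i) (f := fun y : EuclideanSpace ℝ (Fin n) => ‖y‖ ^ 2) h1
    (differentiable_of_contDiff contDiff_norm_sq' x)
  change pd i (groundState n) x = _ at this
  rw [this, pd_norm_sq, groundState, sigmaSq]
  ring

/-- The potential of the conjugated Schrödinger operator. -/
def potential (n : ℕ) (κ : ℝ) (x : EuclideanSpace ℝ (Fin n)) : ℝ :=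
  ‖x‖ ^ 2 * ((sigmaSq n x + 1 / 2) ^ 2 + 2 * sigmaSq n x ^ 2) - n * (sigmaSq n x + 1 / 2) +
    κ * (1 + ‖x‖ ^ 2)

/-- The only negative term is at least -3n/2 because σ² ≤ 1, which fixes the threshold for κ. -/
theorem one_le_potential {κ : ℝ} (hκ : 3 / 2 * (n : ℝ) + 1 ≤ κ) (x : EuclideanSpace ℝ (Fin n)) :
    1 ≤ potential n κ x := by
  unfold potential
  have h1 : (n : ℝ) * (sigmaSq n x + 1 / 2) ≤ n * (3 / 2) :=
    mul_le_mul_of_nonneg_left (by linarith [sigmaSq_le_one (x := x)]) (Nat.cast_nonneg n)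
  have h2 : 0 ≤ ‖x‖ ^ 2 * ((sigmaSq n x + 1 / 2) ^ 2 + 2 * sigmaSq n x ^ 2) := by positivity
  have hκ0 : 0 ≤ κ := by linarith [Nat.cast_nonneg (α := ℝ) n]
  have h3 : 0 ≤ κ * ‖x‖ ^ 2 := by positivity
  nlinarith

/-- Conjugation of the weighted operator to a Schrödinger operator. -/
theorem generator_groundState_mul {ψ : EuclideanSpace ℝ (Fin n) → ℝ} (hψ : ContDiff ℝ ∞ ψ) (κ : ℝ)
    (x : EuclideanSpace ℝ (Fin n)) :
    generator (sigmaSq n) (fun y => groundState n y * ψ y) x - κ * (groundState n x * ψ x) =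
      sigmaSq n x * groundState n x * (∑ i, pd i (pd i ψ) x - potential n κ x * ψ x) := by
  have dK := fun x => differentiable_of_contDiff (contDiff_groundState (n := n)) x
  have ds := fun x => differentiable_of_contDiff (contDiff_sigmaSq (n := n)) x
  have dψ := fun x => differentiable_of_contDiff hψ x
  have dp := fun i x => differentiable_of_contDiff (contDiff_pd (i := i) hψ) x
  have dx := fun i x => differentiable_of_contDiff (contDiff_coord (n := n) i) x
  rw [generator_eq_sum contDiff_sigmaSq (contDiff_groundState.mul hψ)]
  have e1 : ∀ i, (fun y => sigmaSq n y * pd i (fun y => groundState n y * ψ y) y) =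
      fun y => sigmaSq n y * groundState n y *
        (pd i ψ y + y i * ((sigmaSq n y + 1 / 2) * ψ y)) := fun i => by
    funext y
    rw [pd_mul (dK y) (dψ y), pd_groundState]
    ring
  have er : ∀ i, pd i (fun y => sigmaSq n y + 1 / 2) x = pd i (sigmaSq n) x := fun i => by
    rw [pd_add (ds x) (differentiableAt_const _)]
    simp [pd]
  have e2 : ∀ i, pd i (fun y => sigmaSq n y * pd i (fun y => groundState n y * ψ y) y) x -
      x i * (sigmaSq n x * pd i (fun y => groundState n y * ψ y) x) =
      sigmaSq n x * groundState n x * (pd i (pd i ψ) x) +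
        sigmaSq n x * groundState n x * ((sigmaSq n x + 1 / 2) * ψ x) -
        (x i * x i) * (sigmaSq n x * groundState n x *
          (((sigmaSq n x + 1 / 2) ^ 2 + 2 * sigmaSq n x ^ 2) * ψ x)) := fun i => by
    have e3 := congrFun (e1 i) x
    simp only at e3
    have dr : DifferentiableAt ℝ (fun y => sigmaSq n y + 1 / 2) x := (ds x).add_const _
    rw [e3, e1 i, pd_mul ((ds x).fun_mul (dK x))
        ((dp i x).fun_add ((dx i x).fun_mul (dr.fun_mul (dψ x)))),
      pd_mul (ds x) (dK x), pd_add (dp i x) ((dx i x).fun_mul (dr.fun_mul (dψ x))),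
      pd_mul (dx i x) (dr.fun_mul (dψ x)), pd_mul dr (dψ x), er, pd_coord, if_pos rfl,
      pd_groundState, pd_sigmaSq]
    ring
  simp_rw [e2]
  rw [Finset.sum_sub_distrib, Finset.sum_add_distrib, Finset.sum_const, Finset.card_univ,
    Fintype.card_fin, nsmul_eq_mul, ← Finset.sum_mul, sum_coord_sq, ← Finset.mul_sum, potential]
  have hs := sigmaSq_mul (x := x)
  have hs' : sigmaSq n x * (1 + ‖x‖ ^ 2) = 1 := by rw [mul_add, hs]; ring
  have e4 : κ * (groundState n x * ψ x) =
      sigmaSq n x * groundState n x * (κ * (1 + ‖x‖ ^ 2) * ψ x) := by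
    calc κ * (groundState n x * ψ x)
        = (sigmaSq n x * (1 + ‖x‖ ^ 2)) * (κ * (groundState n x * ψ x)) := by rw [hs', one_mul]
      _ = _ := by ring
  rw [e4]
  ring

/-- Essential self-adjointness: a function in `L²(μ)` orthogonal to the range of `L - κ` on test
functions vanishes. -/
theorem ae_eq_zero_of_orthogonal_range {κ : ℝ} (hκ : 3 / 2 * (n : ℝ) + 1 ≤ κ)
    {v : EuclideanSpace ℝ (Fin n) → ℝ} (hv : MemLp v 2 (gaussian n))
    (h : ∀ φ : EuclideanSpace ℝ (Fin n) → ℝ, ContDiff ℝ ∞ φ → HasCompactSupport φ →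
      ∫ x, v x * (generator (sigmaSq n) φ x - κ * φ x) ∂gaussian n = 0) :
    v =ᵐ[gaussian n] 0 := by
  -- The density and the factor σ² of the conjugation formula are absorbed into V. Then V² is a
  -- constant times σ²ρv², hence integrable.
  set V : EuclideanSpace ℝ (Fin n) → ℝ := fun x =>
    v x * (gaussianDensity n x * (sigmaSq n x * groundState n x)) with hVd
  have hVm : AEStronglyMeasurable V volume :=
    (hv.1.mono_ac volume_absolutelyContinuous_gaussian).mul
      (ContDiff.continuous (𝕜 := ℝ) (n := ∞) (by fun_prop)).aestronglyMeasurable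
  have hV : MemLp V 2 := by
    rw [memLp_two_iff_integrable_sq hVm]
    have h1 := (integrable_gaussian_iff _).1 hv.integrable_sq
    refine (h1.const_mul ((2 * Real.pi) ^ (-(n : ℝ) / 2))).mono' (hVm.pow 2)
      (Filter.Eventually.of_forall fun x => ?_)
    rw [Real.norm_of_nonneg (sq_nonneg _)]
    have h2 : gaussianDensity n x * groundState n x ^ 2 =
        (2 * Real.pi) ^ (-(n : ℝ) / 2) * (1 + ‖x‖ ^ 2) := by
      rw [groundState_sq, gaussianDensity]
      have : Real.exp (-‖x‖ ^ 2 / 2) * Real.exp (‖x‖ ^ 2 / 2) = 1 := by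
        rw [← Real.exp_add, neg_div, neg_add_cancel, Real.exp_zero]
      linear_combination ((2 * Real.pi) ^ (-(n : ℝ) / 2) * (1 + ‖x‖ ^ 2)) * this
    have hs := sigmaSq_mul (x := x)
    have hs' : sigmaSq n x * (1 + ‖x‖ ^ 2) = 1 := by rw [mul_add, hs]; ring
    have h3 : V x ^ 2 = sigmaSq n x *
        ((2 * Real.pi) ^ (-(n : ℝ) / 2) * (gaussianDensity n x * v x ^ 2)) := by
      calc V x ^ 2 = v x ^ 2 * gaussianDensity n x * sigmaSq n x ^ 2 *
            (gaussianDensity n x * groundState n x ^ 2) := by rw [hVd]; ring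
        _ = v x ^ 2 * gaussianDensity n x * sigmaSq n x * (2 * Real.pi) ^ (-(n : ℝ) / 2) *
            (sigmaSq n x * (1 + ‖x‖ ^ 2)) := by rw [h2]; ring
        _ = _ := by rw [hs']; ring
    rw [h3]
    have h4 := gaussianDensity_pos x
    exact mul_le_of_le_one_left (by positivity) sigmaSq_le_one
  have hWc : Continuous (potential n κ) := by
    unfold potential
    have := contDiff_norm_sq' (n := n)
    exact ContDiff.continuous (𝕜 := ℝ) (n := ∞) (by fun_prop)
  have hV0 := ae_eq_zero_of_weak_schrodinger hV hWc (one_le_potential hκ) fun ψ hψ hψc => by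
    have h1 := h (fun y => groundState n y * ψ y) (contDiff_groundState.mul hψ) hψc.mul_left
    rw [integral_gaussian] at h1
    rw [← h1]
    refine integral_congr_ae (Filter.Eventually.of_forall fun x => ?_)
    simp only [generator_groundState_mul hψ, hVd]
    ring
  have : v =ᵐ[volume] 0 := by
    filter_upwards [hV0] with x hx
    have h1 := gaussianDensity_pos x
    have h2 := groundState_pos x
    have h3 := sigmaSq_pos (x := x)
    exact (mul_eq_zero.1 hx).resolve_right (by positivity)
  exact gaussian_absolutelyContinuous_volume.ae_le this

end EssentialSelfAdjointness

/-! ### Integrability under polynomial growth. -/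

section Growth

variable {n : ℕ}

theorem integrable_norm_pow_gaussian (k : ℕ) :
    Integrable (fun x : EuclideanSpace ℝ (Fin n) => (1 + ‖x‖) ^ k) (gaussian n) := by
  have h1 : MemLp (fun x : EuclideanSpace ℝ (Fin n) => ‖x‖) (k : ENNReal) (gaussian n) :=
    (IsGaussian.memLp_id (gaussian n) k (by simp)).norm
  have h2 := ((memLp_const (1 : ℝ)).add h1).integrable_norm_pow'
  refine h2.congr (Filter.Eventually.of_forall fun x => ?_)
  simp only [Pi.add_apply]
  rw [Real.norm_of_nonneg (by positivity)]

theorem integrable_of_growth {f : EuclideanSpace ℝ (Fin n) → ℝ} (hf : Continuous f) (B : ℝ) (k : ℕ)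
    (h : ∀ x, |f x| ≤ B * (1 + ‖x‖) ^ k) : Integrable f (gaussian n) :=
  ((integrable_norm_pow_gaussian k).const_mul B).mono' hf.aestronglyMeasurable
    (Filter.Eventually.of_forall h)

theorem abs_coord_le (x : EuclideanSpace ℝ (Fin n)) (i : Fin n) : |x i| ≤ 1 + ‖x‖ :=
  (PiLp.norm_apply_le x i).trans (by linarith)

end Growth

/-! ### Transfer of the test-function identities to L²(μ). -/

section LTwo

variable {n : ℕ}

theorem inner_eq_integral {f g : Lp ℝ 2 (gaussian n)} {a b : EuclideanSpace ℝ (Fin n) → ℝ}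
    (hf : f =ᵐ[gaussian n] a) (hg : g =ᵐ[gaussian n] b) :
    ⟪f, g⟫ = ∫ x, a x * b x ∂gaussian n := by
  rw [L2.inner_def]
  refine integral_congr_ae ?_
  filter_upwards [hf, hg] with x h1 h2
  rw [h1, h2]
  simp [mul_comm]

theorem contDiff_generator {u : EuclideanSpace ℝ (Fin n) → ℝ} (hu : ContDiff ℝ ∞ u) :
    ContDiff ℝ ∞ (generator (sigmaSq n) u) := by
  rw [show generator (sigmaSq n) u = fun x => -∑ i, pdAdj i (fun y => sigmaSq n y * pd i u y) x from
    funext (generator_eq_neg_sum_pdAdj hu)]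
  fun_prop

theorem hasCompactSupport_generator {u : EuclideanSpace ℝ (Fin n) → ℝ} (hu : ContDiff ℝ ∞ u)
    (hc : HasCompactSupport u) : HasCompactSupport (generator (sigmaSq n) u) := by
  refine HasCompactSupport.intro hc.isCompact fun x hx => ?_
  have h2 : ∀ i, x ∉ tsupport (pd i u) := fun i h => hx (tsupport_fderiv_apply_subset ℝ _ h)
  have h3 : ∀ i, x ∉ tsupport (fun y => sigmaSq n y * pd i u y) := fun i h =>
    h2 i (tsupport_mul_subset_right h)
  have h4 : ∀ i, pd i (fun y => sigmaSq n y * pd i u y) x = 0 := fun i => by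
    rw [pd, fderiv_of_notMem_tsupport ℝ (h3 i)]; rfl
  rw [generator_eq_sum contDiff_sigmaSq hu]
  simp [h4, image_eq_zero_of_notMem_tsupport (h2 _)]

theorem memLp_of_hasCompactSupport {f : EuclideanSpace ℝ (Fin n) → ℝ} (hf : Continuous f)
    (hc : HasCompactSupport f) : MemLp f 2 (gaussian n) :=
  hf.memLp_of_hasCompactSupport hc

/-- The element of the graph given by a test function. -/
theorem exists_mem_generatorGraph {u : EuclideanSpace ℝ (Fin n) → ℝ} (hu : ContDiff ℝ ∞ u)
    (hc : HasCompactSupport u) : ∃ p ∈ generatorGraph (sigmaSq n), p.1 =ᵐ[gaussian n] u ∧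
      p.2 =ᵐ[gaussian n] generator (sigmaSq n) u := by
  have h1 := memLp_of_hasCompactSupport hu.continuous hc
  have h2 := memLp_of_hasCompactSupport (contDiff_generator hu).continuous
    (hasCompactSupport_generator hu hc)
  exact ⟨(h1.toLp, h2.toLp), ⟨u, hu, hc, h1.coeFn_toLp, h2.coeFn_toLp⟩, h1.coeFn_toLp,
    h2.coeFn_toLp⟩

theorem eq_zero_of_inner_test_eq_zero (v : Lp ℝ 2 (gaussian n))
    (h : ∀ p ∈ generatorGraph (sigmaSq n), ⟪v, p.1⟫ = 0) : v = 0 := by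
  rw [Lp.eq_zero_iff_ae_eq_zero]
  refine ae_eq_zero_of_integral_contDiff_smul_eq_zero
    ((Lp.memLp v).locallyIntegrable (by norm_num)) fun g hg hgc => ?_
  obtain ⟨p, hp, h1, -⟩ := exists_mem_generatorGraph hg hgc
  have := h p hp
  rw [inner_eq_integral (Filter.EventuallyEq.refl _ v) h1] at this
  simpa [mul_comm] using this

theorem eq_zero_of_inner_range_eq_zero {κ : ℝ} (hκ : 3 / 2 * (n : ℝ) + 1 ≤ κ)
    (v : Lp ℝ 2 (gaussian n))
    (h : ∀ p ∈ generatorGraph (sigmaSq n), ⟪v, p.2 - κ • p.1⟫ = 0) : v = 0 := by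
  rw [Lp.eq_zero_iff_ae_eq_zero]
  refine ae_eq_zero_of_orthogonal_range hκ (Lp.memLp v) fun φ hφ hφc => ?_
  obtain ⟨p, hp, h1, h2⟩ := exists_mem_generatorGraph hφ hφc
  have := h p hp
  rwa [inner_eq_integral (a := v) (b := fun x => generator (sigmaSq n) φ x - κ * φ x)
    (Filter.EventuallyEq.refl _ v)] at this
  have h3 := Lp.coeFn_sub p.2 (κ • p.1)
  have h4 := Lp.coeFn_smul κ p.1
  filter_upwards [h1, h2, h3, h4] with x e1 e2 e3 e4
  rw [e3, Pi.sub_apply, e4, Pi.smul_apply, e1, e2, smul_eq_mul]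

theorem inner_generator {p q : Lp ℝ 2 (gaussian n) × Lp ℝ 2 (gaussian n)}
    {u v : EuclideanSpace ℝ (Fin n) → ℝ} (hu : ContDiff ℝ ∞ u) (huc : HasCompactSupport u)
    (hv : ContDiff ℝ ∞ v) (hp : p.2 =ᵐ[gaussian n] generator (sigmaSq n) u)
    (hq : q.1 =ᵐ[gaussian n] v) :
    ⟪p.2, q.1⟫ = -∫ x, sigmaSq n x * ∑ i, pd i u x * pd i v x ∂gaussian n := by
  rw [inner_eq_integral hp hq, ← integral_generator_mul hu huc hv]
  simp_rw [mul_comm]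

theorem inner_symm_of_mem_generatorGraph {p q : Lp ℝ 2 (gaussian n) × Lp ℝ 2 (gaussian n)}
    (hp : p ∈ generatorGraph (sigmaSq n)) (hq : q ∈ generatorGraph (sigmaSq n)) :
    ⟪p.2, q.1⟫ = ⟪p.1, q.2⟫ := by
  obtain ⟨u, hu, huc, hp1, hp2⟩ := hp
  obtain ⟨v, hv, hvc, hq1, hq2⟩ := hq
  rw [inner_generator hu huc hv hp2 hq1, real_inner_comm, inner_generator hv hvc hu hq2 hp1]
  simp_rw [mul_comm (pd _ u _)]

theorem inner_nonpos_of_mem_generatorGraph {p : Lp ℝ 2 (gaussian n) × Lp ℝ 2 (gaussian n)}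
    (hp : p ∈ generatorGraph (sigmaSq n)) : ⟪p.2, p.1⟫ ≤ 0 := by
  obtain ⟨u, hu, huc, hp1, hp2⟩ := hp
  rw [inner_generator hu huc hu hp2 hp1, neg_nonpos]
  exact integral_nonneg fun x => mul_nonneg sigmaSq_pos.le
    (Finset.sum_nonneg fun i _ => mul_self_nonneg _)

theorem gap_of_mem_generatorGraph (hn : 2 ≤ n) {p : Lp ℝ 2 (gaussian n) × Lp ℝ 2 (gaussian n)}
    (hp : p ∈ generatorGraph (sigmaSq n)) :
    ((n : ℝ) - 1) / (n * (n + 3)) * -⟪p.2, p.1⟫ ≤ ‖p.2‖ ^ 2 := by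
  obtain ⟨u, hu, huc, hp1, hp2⟩ := hp
  rw [inner_generator hu huc hu hp2 hp1, neg_neg, ← real_inner_self_eq_norm_sq,
    inner_eq_integral hp2 hp2]
  simp_rw [← sq (generator (sigmaSq n) u _)]
  exact gap_inequality hn hu huc

end LTwo

/-! ### The closed operator: symmetry, self-adjointness and lower bound on the gap. -/

section Closure

variable {n : ℕ}

theorem induction_closure_generatorGraph
    {P : Lp ℝ 2 (gaussian n) × Lp ℝ 2 (gaussian n) → Prop} (hP : IsClosed {p | P p})
    (h : ∀ p ∈ generatorGraph (sigmaSq n), P p) :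
    ∀ p ∈ (generatorGraph (sigmaSq n)).topologicalClosure, P p :=
  fun _ hp => closure_minimal (t := {p | P p}) h hP hp

theorem inner_symm_of_mem_closure {p q : Lp ℝ 2 (gaussian n) × Lp ℝ 2 (gaussian n)}
    (hp : p ∈ (generatorGraph (sigmaSq n)).topologicalClosure)
    (hq : q ∈ (generatorGraph (sigmaSq n)).topologicalClosure) :
    ⟪p.2, q.1⟫ = ⟪p.1, q.2⟫ := by
  refine induction_closure_generatorGraph (P := fun p => ⟪p.2, q.1⟫ = ⟪p.1, q.2⟫)
    (isClosed_eq (by fun_prop) (by fun_prop)) (fun p hp => ?_) p hp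
  exact induction_closure_generatorGraph (P := fun q => ⟪p.2, q.1⟫ = ⟪p.1, q.2⟫)
    (isClosed_eq (by fun_prop) (by fun_prop))
    (fun q hq => inner_symm_of_mem_generatorGraph hp hq) q hq

/-- If (0, g) is in the closed graph, symmetry makes g orthogonal to every test function, and these
are dense. -/
theorem minimalOperator_isClosable : (minimalOperator (sigmaSq n)).IsClosable := by
  refine ⟨(generatorGraph (sigmaSq n)).topologicalClosure.toLinearPMap, ?_⟩
  rw [minimalOperator_graph, Submodule.toLinearPMap_graph_eq]
  intro p hp hp1
  refine eq_zero_of_inner_test_eq_zero _ fun q hq => ?_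
  rw [inner_symm_of_mem_closure hp (Submodule.le_topologicalClosure _ hq), hp1, inner_zero_left]

theorem diffusionOperator_graph :
    (diffusionOperator (sigmaSq n)).graph = (generatorGraph (sigmaSq n)).topologicalClosure := by
  rw [diffusionOperator, ← minimalOperator_isClosable.graph_closure_eq_closure_graph,
    minimalOperator_graph]

theorem mem_neg_graph_iff (p : Lp ℝ 2 (gaussian n) × Lp ℝ 2 (gaussian n)) :
    p ∈ (-diffusionOperator (sigmaSq n)).graph ↔
      (p.1, -p.2) ∈ (generatorGraph (sigmaSq n)).topologicalClosure := by
  rw [← diffusionOperator_graph, LinearPMap.mem_graph_iff, LinearPMap.mem_graph_iff]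
  constructor
  · rintro ⟨y, h1, h2⟩
    exact ⟨y, h1, by rw [← h2, LinearPMap.neg_apply, neg_neg]⟩
  · rintro ⟨y, h1, h2⟩
    exact ⟨y, h1, by rw [LinearPMap.neg_apply, h2, neg_neg]⟩

theorem mem_closure_of_domain (u : (-diffusionOperator (sigmaSq n)).domain) :
    ((u : Lp ℝ 2 (gaussian n)), -(-diffusionOperator (sigmaSq n)) u) ∈
      (generatorGraph (sigmaSq n)).topologicalClosure :=
  (mem_neg_graph_iff _).1 (LinearPMap.mem_graph _ u)

theorem isClosed_neg_graph :
    IsClosed ((-diffusionOperator (sigmaSq n)).graph :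
      Set (Lp ℝ 2 (gaussian n) × Lp ℝ 2 (gaussian n))) := by
  have h1 := (generatorGraph (sigmaSq n)).isClosed_topologicalClosure
  have h2 : Continuous fun p : Lp ℝ 2 (gaussian n) × Lp ℝ 2 (gaussian n) => (p.1, -p.2) := by
    fun_prop
  convert h1.preimage h2 using 1
  ext p
  exact mem_neg_graph_iff p

theorem isNonnegSymm_neg_diffusionOperator :
    IsNonnegSymm (-diffusionOperator (sigmaSq n)) where
  symm u v := by
    have h := inner_symm_of_mem_closure (mem_closure_of_domain u) (mem_closure_of_domain v)
    simp only [inner_neg_left, inner_neg_right] at h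
    exact neg_injective h
  nonneg u := by
    have := induction_closure_generatorGraph (P := fun p => ⟪p.2, p.1⟫ ≤ 0)
      (isClosed_le (by fun_prop) (by fun_prop)) (fun p hp => inner_nonpos_of_mem_generatorGraph hp)
      _ (mem_closure_of_domain u)
    rw [inner_neg_left] at this
    linarith

theorem gap_neg_diffusionOperator (hn : 2 ≤ n) (u : (-diffusionOperator (sigmaSq n)).domain) :
    ((n : ℝ) - 1) / (n * (n + 3)) *
      ⟪(-diffusionOperator (sigmaSq n)) u, (u : Lp ℝ 2 (gaussian n))⟫ ≤
        ‖(-diffusionOperator (sigmaSq n)) u‖ ^ 2 := by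
  have := induction_closure_generatorGraph
    (P := fun p => ((n : ℝ) - 1) / (n * (n + 3)) * -⟪p.2, p.1⟫ ≤ ‖p.2‖ ^ 2)
    (isClosed_le (by fun_prop) (by fun_prop)) (fun p hp => gap_of_mem_generatorGraph hn hp)
    _ (mem_closure_of_domain u)
  simpa only [inner_neg_left, neg_neg, norm_neg] using this

theorem isResolventPoint_neg_diffusionOperator :
    IsResolventPoint (-diffusionOperator (sigmaSq n)) (-(3 / 2 * (n : ℝ) + 1)) := by
  refine isNonnegSymm_neg_diffusionOperator.isResolventPoint_neg isClosed_neg_graph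
    (by positivity) fun v hv => eq_zero_of_inner_range_eq_zero le_rfl v fun p hp => ?_
  have hmem : (p.1, -p.2) ∈ (-diffusionOperator (sigmaSq n)).graph := by
    rw [mem_neg_graph_iff, neg_neg]
    exact Submodule.le_topologicalClosure _ hp
  obtain ⟨w, hw1, hw2⟩ := (LinearPMap.mem_graph_iff _).1 hmem
  have := hv w
  simp only at hw1 hw2
  rw [hw2, hw1, inner_add_right, inner_neg_right] at this
  rw [inner_sub_right]
  linarith

theorem gap_mem_gapSet (hn : 2 ≤ n) :
    ((n : ℝ) - 1) / (n * (n + 3)) ∈ gapSet (-diffusionOperator (sigmaSq n)) := by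
  intro lam hlam
  by_contra hcon
  rw [Set.mem_union, not_or] at hcon
  exact hlam (isNonnegSymm_neg_diffusionOperator.isResolventPoint_of_lt isClosed_neg_graph
    isResolventPoint_neg_diffusionOperator (gap_neg_diffusionOperator hn) hcon.1
    (not_le.1 hcon.2))

end Closure

/-! ### Coordinate functions, the upper bound and the asymptotics. -/

section LinearFunction

variable {n : ℕ}

theorem continuous_sigmaSq : Continuous (sigmaSq n) := contDiff_sigmaSq.continuous

theorem integrable_sigmaSq : Integrable (sigmaSq n) (gaussian n) :=
  integrable_of_growth continuous_sigmaSq 1 0 fun x => by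
    rw [abs_of_pos sigmaSq_pos]; simpa using sigmaSq_le_one

theorem sq_coord_le (x : EuclideanSpace ℝ (Fin n)) (i : Fin n) :
    x i * x i ≤ (1 + ‖x‖) ^ 2 := by
  rw [← sq, ← sq_abs]
  exact pow_le_pow_left₀ (abs_nonneg _) (abs_coord_le x i) 2

theorem integrable_coord_mul_sq {g : EuclideanSpace ℝ (Fin n) → ℝ} (hg : Continuous g) (B : ℝ)
    (hB : ∀ x, |g x| ≤ B) (i : Fin n) :
    Integrable (fun x => x i * x i * g x) (gaussian n) :=
  integrable_of_growth (by fun_prop) B 2 fun x => by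
    rw [abs_mul, abs_of_nonneg (mul_self_nonneg _), mul_comm B]
    exact mul_le_mul (sq_coord_le x i) (hB x) (abs_nonneg _) (by positivity)

theorem integrable_coord_mul {g : EuclideanSpace ℝ (Fin n) → ℝ} (hg : Continuous g) (B : ℝ)
    (hB : ∀ x, |g x| ≤ B) (i : Fin n) :
    Integrable (fun x => x i * g x) (gaussian n) :=
  integrable_of_growth (by fun_prop) B 1 fun x => by
    rw [abs_mul, mul_comm B, pow_one]
    exact mul_le_mul (abs_coord_le x i) (hB x) (abs_nonneg _) (by positivity)

theorem abs_sigmaSq_le (x : EuclideanSpace ℝ (Fin n)) : |sigmaSq n x| ≤ 1 := by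
  rw [abs_of_pos sigmaSq_pos]; exact sigmaSq_le_one

theorem abs_sigmaSq_sq_le (x : EuclideanSpace ℝ (Fin n)) : |sigmaSq n x ^ 2| ≤ 1 := by
  rw [abs_pow]; exact pow_le_one₀ (abs_nonneg _) (abs_sigmaSq_le x)

theorem integral_coord_sq (i : Fin n) : ∫ x, x i * x i ∂gaussian n = 1 := by
  have h1 : Integrable (fun x : EuclideanSpace ℝ (Fin n) => x i * x i) (gaussian n) := by
    simpa using integrable_coord_mul_sq (n := n) (g := fun _ => 1) continuous_const 1 (by simp) i
  have h2 : Integrable (fun x : EuclideanSpace ℝ (Fin n) => x i) (gaussian n) := by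
    simpa using integrable_coord_mul (n := n) (g := fun _ => 1) continuous_const 1 (by simp) i
  have h3 : ∀ x, pd i (fun y : EuclideanSpace ℝ (Fin n) => y i) x = 1 := fun x => by
    rw [pd_coord, if_pos rfl]
  have := integral_pd_gaussian i (differentiable_of_contDiff (contDiff_coord i)) h2
    (by simp only [funext h3]; exact integrable_const _) h1
  rw [← this]
  simp [h3]

theorem pd_coord_mul_sigmaSq (i : Fin n) (x : EuclideanSpace ℝ (Fin n)) :
    pd i (fun y => y i * sigmaSq n y) x = sigmaSq n x - 2 * (x i * x i * sigmaSq n x ^ 2) := by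
  rw [pd_mul (differentiable_of_contDiff (contDiff_coord i) x)
    (differentiable_of_contDiff contDiff_sigmaSq x), pd_coord, if_pos rfl, pd_sigmaSq]
  ring

theorem integrable_coord_sq_sigmaSq (i : Fin n) :
    Integrable (fun x => x i * x i * sigmaSq n x) (gaussian n) :=
  integrable_coord_mul_sq continuous_sigmaSq 1 abs_sigmaSq_le i

theorem integrable_coord_sq_sigmaSq_sq (i : Fin n) :
    Integrable (fun x => x i * x i * sigmaSq n x ^ 2) (gaussian n) :=
  integrable_coord_mul_sq (continuous_sigmaSq.pow 2) 1 abs_sigmaSq_sq_le i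

theorem integral_coord_sq_sigmaSq (i : Fin n) :
    ∫ x, x i * x i * sigmaSq n x ∂gaussian n =
      ∫ x, sigmaSq n x ∂gaussian n - 2 * ∫ x, x i * x i * sigmaSq n x ^ 2 ∂gaussian n := by
  have h := integral_pd_gaussian i (f := fun y => y i * sigmaSq n y)
    (differentiable_of_contDiff ((contDiff_coord i).mul contDiff_sigmaSq))
    (integrable_coord_mul continuous_sigmaSq 1 abs_sigmaSq_le i)
    (by
      simp only [funext (pd_coord_mul_sigmaSq i)]
      exact integrable_sigmaSq.sub ((integrable_coord_sq_sigmaSq_sq i).const_mul 2))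
    (by simpa only [mul_assoc] using integrable_coord_sq_sigmaSq i)
  simp_rw [pd_coord_mul_sigmaSq, ← mul_assoc (_ : ℝ) _ (sigmaSq n _)] at h
  rw [← h, integral_sub integrable_sigmaSq ((integrable_coord_sq_sigmaSq_sq i).const_mul 2),
    integral_const_mul]

/-- Summing `integral_coord_sq_sigmaSq` over i and using |x|²σ² = 1 - σ² gives (n-1)∫σ² + 2∫σ⁴ = 1.
-/
theorem integral_sigmaSq_le (hn : 2 ≤ n) : ∫ x, sigmaSq n x ∂gaussian n ≤ 1 / ((n : ℝ) - 1) := by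
  have hn' : (2 : ℝ) ≤ n := by exact_mod_cast hn
  have h1 : ∑ i : Fin n, ∫ x, x i * x i * sigmaSq n x ∂gaussian n =
      1 - ∫ x, sigmaSq n x ∂gaussian n := by
    rw [← integral_finsetSum _ fun i _ => integrable_coord_sq_sigmaSq i]
    simp_rw [← Finset.sum_mul, sum_coord_sq, mul_comm (_ ^ 2), sigmaSq_mul]
    rw [integral_sub (integrable_const _) integrable_sigmaSq]
    simp
  have i2 : Integrable (fun x => sigmaSq n x ^ 2) (gaussian n) :=
    integrable_of_growth (continuous_sigmaSq.pow 2) 1 0 fun x => by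
      simpa using abs_sigmaSq_sq_le x
  have h2 : ∑ i : Fin n, ∫ x, x i * x i * sigmaSq n x ^ 2 ∂gaussian n =
      ∫ x, sigmaSq n x ∂gaussian n - ∫ x, sigmaSq n x ^ 2 ∂gaussian n := by
    rw [← integral_finsetSum _ fun i _ => integrable_coord_sq_sigmaSq_sq i,
      ← integral_sub integrable_sigmaSq i2]
    refine integral_congr_ae (Filter.Eventually.of_forall fun x => ?_)
    simp only [← Finset.sum_mul, sum_coord_sq]
    linear_combination sigmaSq n x * sigmaSq_mul (x := x)
  simp_rw [integral_coord_sq_sigmaSq] at h1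
  rw [Finset.sum_sub_distrib, ← Finset.mul_sum, h2, Finset.sum_const, Finset.card_univ,
    Fintype.card_fin, nsmul_eq_mul] at h1
  have h3 : 0 ≤ ∫ x, sigmaSq n x ^ 2 ∂gaussian n := integral_nonneg fun x => sq_nonneg _
  rw [le_div_iff₀ (by linarith)]
  linarith

theorem generator_eq_sum_pd_pd {u : EuclideanSpace ℝ (Fin n) → ℝ} (hu : ContDiff ℝ ∞ u)
    (x : EuclideanSpace ℝ (Fin n)) :
    generator (sigmaSq n) u x =
      ∑ j, sigmaSq n x * (pd j (pd j u) x - x j * (1 + 2 * sigmaSq n x) * pd j u x) := by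
  rw [generator_eq_sum contDiff_sigmaSq hu]
  refine Finset.sum_congr rfl fun j _ => ?_
  rw [pd_mul (differentiable_of_contDiff contDiff_sigmaSq x)
    (differentiable_of_contDiff (contDiff_pd hu) x), pd_sigmaSq]
  ring

theorem generator_coord (i : Fin n) (x : EuclideanSpace ℝ (Fin n)) :
    generator (sigmaSq n) (fun y => y i) x =
      -(x i * (sigmaSq n x * (1 + 2 * sigmaSq n x))) := by
  rw [generator_eq_sum_pd_pd (contDiff_coord i)]
  have h1 : ∀ j, pd j (fun y : EuclideanSpace ℝ (Fin n) => y i) =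
      fun _ => if j = i then (1 : ℝ) else 0 := fun j => funext fun x => pd_coord
  have h2 : ∀ j, pd j (pd j (fun y : EuclideanSpace ℝ (Fin n) => y i)) x = 0 := fun j => by
    rw [h1]; simp [pd]
  simp_rw [h2, h1]
  simp
  ring

/-- Growth of the weighted operator on a truncated linear function. -/
theorem abs_generator_cutoff_le {χ : EuclideanSpace ℝ (Fin n) → ℝ} {C : ℝ} (hC : 0 ≤ C)
    (hχ : ContDiff ℝ ∞ χ) (h0 : ∀ x, 0 ≤ χ x ∧ χ x ≤ 1) (h1 : ∀ i x, |pd i χ x| ≤ C)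
    (h2 : ∀ i x, |pd i (pd i χ) x| ≤ C) (i : Fin n) (x : EuclideanSpace ℝ (Fin n)) :
    |generator (sigmaSq n) (fun y => χ y * y i) x| ≤ n * (9 * C + 3) * (1 + ‖x‖) ^ 2 := by
  rw [generator_eq_sum_pd_pd (hχ.mul (contDiff_coord i))]
  have dχ := fun x => differentiable_of_contDiff hχ x
  have dx := fun x => differentiable_of_contDiff (contDiff_coord i) x
  set r := 1 + ‖x‖ with hr
  have hr1 : 1 ≤ r := by rw [hr]; linarith [norm_nonneg x]
  have e0 : ∀ j, pd j (fun y : EuclideanSpace ℝ (Fin n) => χ y * y i) =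
      fun y => χ y * (if j = i then (1 : ℝ) else 0) + pd j χ y * y i := fun j => funext fun y => by
    rw [pd_mul (dχ y) (dx y), pd_coord]
  have hδ : ∀ j, |(if j = i then (1 : ℝ) else 0)| ≤ 1 := fun j => by split_ifs <;> simp
  have hxi : ∀ j, |x j| ≤ r := fun j => abs_coord_le x j
  have e1 : ∀ j, |pd j (fun y : EuclideanSpace ℝ (Fin n) => χ y * y i) x| ≤ 1 + C * r := fun j => by
    rw [e0]
    refine (abs_add_le _ _).trans (add_le_add ?_ ?_)
    · rw [abs_mul, abs_of_nonneg (h0 x).1]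
      exact mul_le_one₀ (h0 x).2 (abs_nonneg _) (hδ j)
    · rw [abs_mul]
      exact mul_le_mul (h1 j x) (hxi i) (abs_nonneg _) hC
  have e2 : ∀ j, |pd j (pd j (fun y : EuclideanSpace ℝ (Fin n) => χ y * y i)) x| ≤
      2 * C + C * r := fun j => by
    have dp := differentiable_of_contDiff (contDiff_pd (i := j) hχ) x
    have e3 : pd j (pd j (fun y : EuclideanSpace ℝ (Fin n) => χ y * y i)) x =
        2 * (pd j χ x * (if j = i then (1 : ℝ) else 0)) + pd j (pd j χ) x * x i := by
      rw [e0, pd_add ((dχ x).fun_mul (differentiableAt_const _)) (dp.fun_mul (dx x)),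
        pd_mul (dχ x) (differentiableAt_const _), pd_mul dp (dx x), pd_coord]
      simp only [pd, fderiv_const_apply, zero_apply]
      ring_nf
    rw [e3]
    refine (abs_add_le _ _).trans (add_le_add ?_ ?_)
    · rw [abs_mul, abs_mul, abs_two]
      have := mul_le_mul (h1 j x) (hδ j) (abs_nonneg _) hC
      linarith
    · rw [abs_mul]
      exact mul_le_mul (h2 j x) (hxi i) (abs_nonneg _) hC
  have hs1 := sigmaSq_le_one (x := x)
  have hs0 := sigmaSq_pos (x := x)
  have e4 : ∀ j ∈ Finset.univ, |sigmaSq n x *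
      (pd j (pd j (fun y : EuclideanSpace ℝ (Fin n) => χ y * y i)) x -
        x j * (1 + 2 * sigmaSq n x) * pd j (fun y => χ y * y i) x)| ≤
      (9 * C + 3) * r ^ 2 := fun j _ => by
    rw [abs_mul, abs_of_pos hs0]
    refine (mul_le_of_le_one_left (abs_nonneg _) hs1).trans ((abs_sub _ _).trans ?_)
    rw [abs_mul, abs_mul, abs_of_pos (show 0 < 1 + 2 * sigmaSq n x by linarith)]
    have h5 : |x j| * (1 + 2 * sigmaSq n x) ≤ r * 3 :=
      mul_le_mul (hxi j) (by linarith) (by linarith) (by linarith)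
    have h6 := mul_le_mul h5 (e1 j) (abs_nonneg _) (by linarith)
    have h7 := e2 j
    have h8 : C ≤ C * r ^ 2 := le_mul_of_one_le_right hC (one_le_pow₀ hr1)
    have h9 : C * r ≤ C * r ^ 2 := mul_le_mul_of_nonneg_left (by nlinarith) hC
    nlinarith
  refine (Finset.abs_sum_le_sum_abs _ _).trans ((Finset.sum_le_card_nsmul _ _ _ e4).trans_eq ?_)
  simp
  ring

theorem generator_congr {w u v : EuclideanSpace ℝ (Fin n) → ℝ} {x : EuclideanSpace ℝ (Fin n)}
    (h : u =ᶠ[nhds x] v) : generator w u x = generator w v x := by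
  rw [generator, generator, h.gradient_eq, (InnerProductSpace.laplacian_congr_nhds h).eq_of_nhds]

theorem memLp_of_growth {f : EuclideanSpace ℝ (Fin n) → ℝ} (hf : Continuous f) (B : ℝ) (k : ℕ)
    (h : ∀ x, |f x| ≤ B * (1 + ‖x‖) ^ k) : MemLp f 2 (gaussian n) := by
  rw [memLp_two_iff_integrable_sq hf.aestronglyMeasurable]
  refine integrable_of_growth (hf.pow 2) (B ^ 2) (k * 2) fun x => ?_
  rw [abs_pow, pow_mul, ← mul_pow]
  exact pow_le_pow_left₀ (abs_nonneg _) (h x) 2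

/-- Convergence in `L²(μ)` of an eventually constant sequence with polynomial growth. -/
theorem tendsto_Lp_of_growth {f : ℕ → Lp ℝ 2 (gaussian n)} {f₀ : Lp ℝ 2 (gaussian n)}
    {a : ℕ → EuclideanSpace ℝ (Fin n) → ℝ} {a₀ : EuclideanSpace ℝ (Fin n) → ℝ}
    (hf : ∀ k, f k =ᵐ[gaussian n] a k) (hf₀ : f₀ =ᵐ[gaussian n] a₀) (ha : ∀ k, Continuous (a k))
    (ha₀ : Continuous a₀) (B : ℝ) (hB : ∀ k x, |a k x| ≤ B * (1 + ‖x‖) ^ 2)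
    (hB₀ : ∀ x, |a₀ x| ≤ B * (1 + ‖x‖) ^ 2)
    (hev : ∀ x, ∀ᶠ k in Filter.atTop, a k x = a₀ x) :
    Filter.Tendsto f Filter.atTop (nhds f₀) := by
  rw [tendsto_iff_norm_sub_tendsto_zero]
  have h1 : ∀ k, ‖f k - f₀‖ ^ 2 = ∫ x, (a k x - a₀ x) * (a k x - a₀ x) ∂gaussian n := fun k => by
    have : (f k - f₀ : Lp ℝ 2 (gaussian n)) =ᵐ[gaussian n] fun x => a k x - a₀ x := by
      filter_upwards [Lp.coeFn_sub (f k) f₀, hf k, hf₀] with x e1 e2 e3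
      rw [e1, Pi.sub_apply, e2, e3]
    rw [← real_inner_self_eq_norm_sq, inner_eq_integral this this]
  have h2 : Filter.Tendsto (fun k => ∫ x, (a k x - a₀ x) * (a k x - a₀ x) ∂gaussian n)
      Filter.atTop (nhds (∫ _, (0 : ℝ) ∂gaussian n)) := by
    refine tendsto_integral_of_dominated_convergence (fun x => (2 * B) ^ 2 * (1 + ‖x‖) ^ 4)
      (fun k => (((ha k).sub ha₀).mul ((ha k).sub ha₀)).aestronglyMeasurable)
      ((integrable_norm_pow_gaussian 4).const_mul _)
      (fun k => Filter.Eventually.of_forall fun x => ?_)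
      (Filter.Eventually.of_forall fun x => ?_)
    · rw [Real.norm_eq_abs, ← sq, abs_pow]
      have h3 : |a k x - a₀ x| ≤ 2 * B * (1 + ‖x‖) ^ 2 :=
        (abs_sub _ _).trans (by linarith [hB k x, hB₀ x])
      refine (pow_le_pow_left₀ (abs_nonneg _) h3 2).trans_eq ?_
      ring
    · refine tendsto_const_nhds.congr' ?_
      filter_upwards [hev x] with k hk
      rw [hk]; ring
  rw [integral_zero] at h2
  have h3 : ∀ k, ‖f k - f₀‖ = Real.sqrt (∫ x, (a k x - a₀ x) * (a k x - a₀ x) ∂gaussian n) :=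
    fun k => by rw [← h1, Real.sqrt_sq (norm_nonneg _)]
  simp_rw [h3]
  have h4 := (Real.continuous_sqrt.tendsto _).comp h2
  rw [Real.sqrt_zero] at h4
  exact h4

theorem abs_generator_coord_le (i : Fin n) (x : EuclideanSpace ℝ (Fin n)) :
    |generator (sigmaSq n) (fun y => y i) x| ≤ 3 * (1 + ‖x‖) ^ 2 := by
  rw [generator_coord, abs_neg, abs_mul]
  have hs1 := sigmaSq_le_one (x := x)
  have hs0 := sigmaSq_pos (x := x)
  have h1 : |sigmaSq n x * (1 + 2 * sigmaSq n x)| ≤ 3 := by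
    rw [abs_of_pos (by positivity)]; nlinarith
  have h2 := mul_le_mul (abs_coord_le x i) h1 (abs_nonneg _) (by positivity)
  nlinarith [norm_nonneg x]

/-- The linear functions belong to the domain of the closed operator. -/
theorem exists_coord_mem_closure (i : Fin n) :
    ∃ p ∈ (generatorGraph (sigmaSq n)).topologicalClosure,
      p.1 =ᵐ[gaussian n] (fun x => x i) ∧
      p.2 =ᵐ[gaussian n] generator (sigmaSq n) (fun x => x i) := by
  obtain ⟨C, hC, χ, hχ⟩ := exists_cutoff n
  have hn : (1 : ℝ) ≤ n := by exact_mod_cast i.pos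
  have m1 : MemLp (fun x : EuclideanSpace ℝ (Fin n) => x i) 2 (gaussian n) :=
    memLp_of_growth (by fun_prop) 1 1 fun x => by simpa using abs_coord_le x i
  have m2 : MemLp (generator (sigmaSq n) (fun x => x i)) 2 (gaussian n) :=
    memLp_of_growth (contDiff_generator (contDiff_coord i)).continuous 3 2
      (abs_generator_coord_le i)
  have hs : ∀ k, ContDiff ℝ ∞ (fun y : EuclideanSpace ℝ (Fin n) => χ k y * y i) := fun k =>
    (hχ k).1.mul (contDiff_coord i)
  have hp := fun k => exists_mem_generatorGraph (hs k) (hχ k).2.1.mul_right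
  choose p hpm hp1 hp2 using hp
  refine ⟨(m1.toLp, m2.toLp), ?_, m1.coeFn_toLp, m2.coeFn_toLp⟩
  -- Agreement is needed on a neighbourhood, since the generator sees derivatives; the cutoff radius
  -- k + 1 leaves room for it.
  have hev : ∀ x : EuclideanSpace ℝ (Fin n), ∀ᶠ k in Filter.atTop,
      (fun y => χ k y * y i) =ᶠ[nhds x] fun y => y i := fun x => by
    filter_upwards [Filter.eventually_ge_atTop ⌈‖x‖⌉₊] with k hk
    have hxk : x ∈ Metric.ball (0 : EuclideanSpace ℝ (Fin n)) (k + 1) := by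
      rw [mem_ball_zero_iff]
      linarith [Nat.ceil_le.1 hk]
    filter_upwards [Metric.isOpen_ball.mem_nhds hxk] with y hy
    rw [(hχ k).2.2.2.1 y (mem_ball_zero_iff.1 hy).le, one_mul]
  have hC' : ∀ k : ℕ, C / (k + 1) ≤ C := fun k =>
    div_le_self hC (by linarith [Nat.cast_nonneg (α := ℝ) k])
  have hB : ∀ x : EuclideanSpace ℝ (Fin n), 3 * (1 + ‖x‖) ^ 2 ≤
      n * (9 * C + 3) * (1 + ‖x‖) ^ 2 := fun x =>
    mul_le_mul_of_nonneg_right (by nlinarith) (by positivity)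
  have hcoord : ∀ x : EuclideanSpace ℝ (Fin n), |x i| ≤ 3 * (1 + ‖x‖) ^ 2 := fun x =>
    (abs_coord_le x i).trans (by nlinarith [norm_nonneg x])
  have t1 : Filter.Tendsto (fun k => (p k).1) Filter.atTop (nhds m1.toLp) :=
    tendsto_Lp_of_growth hp1 m1.coeFn_toLp (fun k => (hs k).continuous) (by fun_prop)
      (n * (9 * C + 3)) (fun k x => by
        rw [abs_mul, abs_of_nonneg ((hχ k).2.2.1 x).1]
        exact (mul_le_of_le_one_left (abs_nonneg _) ((hχ k).2.2.1 x).2).trans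
          ((hcoord x).trans (hB x)))
      (fun x => (hcoord x).trans (hB x)) (fun x => (hev x).mono fun k hk => hk.eq_of_nhds)
  have t2 : Filter.Tendsto (fun k => (p k).2) Filter.atTop (nhds m2.toLp) :=
    tendsto_Lp_of_growth hp2 m2.coeFn_toLp (fun k => (contDiff_generator (hs k)).continuous)
      (contDiff_generator (contDiff_coord i)).continuous (n * (9 * C + 3))
      (fun k x => abs_generator_cutoff_le hC (hχ k).1 (hχ k).2.2.1
        (fun i x => ((hχ k).2.2.2.2.1 i x).trans (hC' k))
        (fun i x => ((hχ k).2.2.2.2.2 i x).trans (hC' k)) i x)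
      (fun x => (abs_generator_coord_le i x).trans (hB x))
      (fun x => (hev x).mono fun k hk => generator_congr hk)
  exact mem_closure_of_tendsto (t1.prodMk_nhds t2) (Filter.Eventually.of_forall hpm)

/-- Linear functions are orthogonal to the kernel. -/
theorem inner_coord_eq_zero (i : Fin n) {e k : Lp ℝ 2 (gaussian n)}
    (he : e =ᵐ[gaussian n] fun x => x i)
    (hk : (k, 0) ∈ (generatorGraph (sigmaSq n)).topologicalClosure) : ⟪e, k⟫ = 0 := by
  set M : ℝ := ∫ x, (1 + ‖x‖ ^ 2) ∂gaussian n with hM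
  have iM : Integrable (fun x : EuclideanSpace ℝ (Fin n) => 1 + ‖x‖ ^ 2) (gaussian n) :=
    integrable_of_growth (by fun_prop) 1 2 fun x => by
      rw [abs_of_pos (by positivity)]
      nlinarith [norm_nonneg x]
  -- On test functions ⟨xᵢ, u⟩ = ∫ ∂ᵢu, and 2a∂ᵢu ≤ σ²(∂ᵢu)² + a²/σ². The resulting bound by the
  -- energy plus a²M passes to the closure, and a kernel element has zero energy.
  have hcl : ∀ a : ℝ, 2 * a * ⟪e, k⟫ ≤ a ^ 2 * M := fun a => by
    have := induction_closure_generatorGraph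
      (P := fun p => 2 * a * ⟪e, p.1⟫ ≤ -⟪p.2, p.1⟫ + a ^ 2 * M)
      (isClosed_le (by fun_prop) (by fun_prop)) (fun p hp => ?_) _ hk
    · simpa using this
    obtain ⟨u, hu, huc, hp1, hp2⟩ := hp
    rw [inner_generator hu huc hu hp2 hp1, neg_neg, inner_eq_integral he hp1,
      ← integral_pd_gaussian_of_hasCompactSupport i hu huc, ← integral_const_mul,
      hM, ← integral_const_mul]
    have i1 : Integrable (fun x => 2 * a * pd i u x) (gaussian n) :=
      (integrable_of_hasCompactSupport (contDiff_pd hu).continuous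
        (hasCompactSupport_pd huc)).const_mul _
    have i2 : Integrable (fun x => sigmaSq n x * ∑ j, pd j u x * pd j u x) (gaussian n) := by
      simp_rw [Finset.mul_sum]
      exact integrable_finsetSum _ fun j _ => integrable_of_hasCompactSupport
        (ContDiff.continuous (𝕜 := ℝ) (n := ∞) (by fun_prop))
        (hasCompactSupport_of_zero (hasCompactSupport_pd (i := j) huc) fun x hx => by simp [hx])
    rw [← integral_add i2 (iM.const_mul _)]
    refine integral_mono i1 (i2.add (iM.const_mul _)) fun x => ?_
    have h1 : pd i u x * pd i u x ≤ ∑ j, pd j u x * pd j u x :=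
      Finset.single_le_sum (f := fun j => pd j u x * pd j u x) (fun j _ => mul_self_nonneg _)
        (Finset.mem_univ i)
    have h2 := mul_le_mul_of_nonneg_left h1 (sigmaSq_pos (x := x)).le
    have h3 : sigmaSq n x * (1 + ‖x‖ ^ 2) = 1 := by rw [mul_add, sigmaSq_mul]; ring
    have h4 : 0 ≤ sigmaSq n x * (pd i u x - a * (1 + ‖x‖ ^ 2)) ^ 2 :=
      mul_nonneg sigmaSq_pos.le (sq_nonneg _)
    have h5 : sigmaSq n x * (pd i u x - a * (1 + ‖x‖ ^ 2)) ^ 2 =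
        sigmaSq n x * (pd i u x * pd i u x) - 2 * a * pd i u x + a ^ 2 * (1 + ‖x‖ ^ 2) := by
      linear_combination (-2 * a * pd i u x + a ^ 2 * (1 + ‖x‖ ^ 2)) * h3
    simp only
    linarith
  have hM0 : 0 ≤ M := integral_nonneg fun x => by positivity
  -- A linear term bounded by a quadratic one for every a must vanish; M + 1 rather than M keeps the
  -- denominator positive.
  have h1 := hcl (⟪e, k⟫ / (M + 1))
  have hM1 : 0 < M + 1 := by linarith
  have h2 : ⟪e, k⟫ ^ 2 * (M + 2) ≤ 0 := by
    rw [div_pow, mul_div_assoc', div_mul_eq_mul_div, div_mul_eq_mul_div,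
      div_le_div_iff₀ hM1 (by positivity)] at h1
    have h6 : 0 ≤ (M + 1) * -(⟪e, k⟫ ^ 2 * (M + 2)) := by nlinarith
    have := nonneg_of_mul_nonneg_right h6 hM1
    linarith
  have h3 : ⟪e, k⟫ ^ 2 ≤ 0 := nonpos_of_mul_nonpos_left h2 (by linarith)
  exact pow_eq_zero_iff (two_ne_zero) |>.1 (le_antisymm h3 (sq_nonneg _))

/-- The upper bound on the gap set given by the linear test functions. -/
theorem le_of_mem_gapSet (hn : 2 ≤ n) {lam : ℝ}
    (hlam : lam ∈ gapSet (-diffusionOperator (sigmaSq n))) : lam ≤ 1 / ((n : ℝ) - 1) := by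
  have hn' : (2 : ℝ) ≤ n := by exact_mod_cast hn
  let i : Fin n := ⟨0, by omega⟩
  obtain ⟨p, hp, h1, h2⟩ := exists_coord_mem_closure i
  have hmem : (p.1, -p.2) ∈ (-diffusionOperator (sigmaSq n)).graph := by
    rw [mem_neg_graph_iff, neg_neg]; exact hp
  obtain ⟨w, hw1, hw2⟩ := (LinearPMap.mem_graph_iff _).1 hmem
  simp only at hw1 hw2
  have hnorm : ‖(w : Lp ℝ 2 (gaussian n))‖ ^ 2 = 1 := by
    rw [hw1, ← real_inner_self_eq_norm_sq, inner_eq_integral h1 h1, integral_coord_sq]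
  refine isNonnegSymm_neg_diffusionOperator.le_rayleigh_of_mem_gapSet
    isResolventPoint_neg_diffusionOperator (c := ((n : ℝ) - 1) / (n * (n + 3)))
    (div_pos (by linarith) (by positivity)) (gap_neg_diffusionOperator hn) w (fun h => ?_)
    (fun k hk => ?_) ?_ hlam
  · rw [h] at hnorm; simp at hnorm
  · rw [hw1]
    refine inner_coord_eq_zero i h1 ?_
    have := mem_closure_of_domain k
    rwa [hk, neg_zero] at this
  -- The Rayleigh quotient of xᵢ is ∫(xᵢ²σ² + 2xᵢ²σ⁴), which integration by parts reduces to ∫σ².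
  · rw [hnorm, mul_one, hw2, hw1, inner_neg_left, inner_eq_integral h2 h1]
    have e1 : ∀ x : EuclideanSpace ℝ (Fin n), generator (sigmaSq n) (fun x => x i) x * x i =
        -(x i * x i * sigmaSq n x + 2 * (x i * x i * sigmaSq n x ^ 2)) := fun x => by
      rw [generator_coord]; ring
    simp_rw [e1]
    rw [integral_neg, neg_neg, integral_add (integrable_coord_sq_sigmaSq i)
      ((integrable_coord_sq_sigmaSq_sq i).const_mul 2), integral_const_mul,
      integral_coord_sq_sigmaSq, sub_add_cancel]
    exact integral_sigmaSq_le hn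

theorem isGreatest_lambdaOne (hn : 2 ≤ n) :
    IsGreatest (gapSet (-diffusionOperator (sigmaSq n))) (lambdaOne n) :=
  isGreatest_spectralGap ⟨_, gap_mem_gapSet hn⟩ ⟨_, fun _ h => le_of_mem_gapSet hn h⟩

/-- Squeeze n·λ₁ between (n-1)/(n+3) and n/(n-1). -/
theorem lambdaOne_isEquivalent :
    Asymptotics.IsEquivalent Filter.atTop (fun n : ℕ => lambdaOne n) (fun n : ℕ => 1 / (n : ℝ)) := by
  have hinv := tendsto_inv_atTop_nhds_zero_nat (𝕜 := ℝ)
  refine Asymptotics.isEquivalent_of_tendsto_one ?_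
  have hlow : Filter.Tendsto (fun n : ℕ => (1 - (n : ℝ)⁻¹) / (1 + 3 * (n : ℝ)⁻¹)) Filter.atTop
      (nhds 1) := by
    have := (hinv.const_sub 1).div ((hinv.const_mul 3).const_add 1) (by simp)
    simp only [mul_zero, sub_zero, add_zero, div_one] at this
    exact this
  have hupp : Filter.Tendsto (fun n : ℕ => 1 / (1 - (n : ℝ)⁻¹)) Filter.atTop (nhds 1) := by
    have := (tendsto_const_nhds (x := (1 : ℝ))).div (hinv.const_sub 1) (by simp)
    simp only [sub_zero, div_one] at this
    exact this
  refine tendsto_of_tendsto_of_tendsto_of_le_of_le' hlow hupp ?_ ?_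
  · filter_upwards [Filter.eventually_ge_atTop 2] with n hn
    have hn' : (2 : ℝ) ≤ n := by exact_mod_cast hn
    have h := (isGreatest_lambdaOne hn).2 (gap_mem_gapSet hn)
    rw [Pi.div_apply, le_div_iff₀ (by positivity)]
    refine le_trans (le_of_eq ?_) h
    field_simp
  · filter_upwards [Filter.eventually_ge_atTop 2] with n hn
    have hn' : (2 : ℝ) ≤ n := by exact_mod_cast hn
    have h := le_of_mem_gapSet hn (isGreatest_lambdaOne hn).1
    have h1 : (0 : ℝ) < n - 1 := by linarith
    have h2 : (1 : ℝ) - (n : ℝ)⁻¹ ≠ 0 := by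
      have : (n : ℝ)⁻¹ < 1 := inv_lt_one_of_one_lt₀ (by linarith)
      linarith
    rw [Pi.div_apply, div_le_iff₀ (by positivity)]
    refine h.trans (le_of_eq ?_)
    field_simp

end LinearFunction

end WeightedGaussian

end

theorem mainTheorem9 :
    (∀ n : ℕ, 2 ≤ n →
      -- the spectral gap is well defined: the largest real is attained
      IsGreatest (WeightedGaussian.gapSet
          (-WeightedGaussian.diffusionOperator (WeightedGaussian.sigmaSq n)))
        (WeightedGaussian.lambdaOne n) ∧
      ((n : ℝ) - 1) / ((n : ℝ) * ((n : ℝ) + 3)) ≤ WeightedGaussian.lambdaOne n ∧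
      WeightedGaussian.lambdaOne n ≤ 1 ∧
      -- for `n = 2` the bound `1 / (n - 2)` is `+∞`, hence void
      (3 ≤ n → WeightedGaussian.lambdaOne n ≤ 1 / ((n : ℝ) - 2))) ∧
    Asymptotics.IsEquivalent Filter.atTop
      (fun n : ℕ => WeightedGaussian.lambdaOne n) (fun n : ℕ => 1 / (n : ℝ)) := by
  refine ⟨fun n hn => ?_, WeightedGaussian.lambdaOne_isEquivalent⟩
  have hn' : (2 : ℝ) ≤ n := by exact_mod_cast hn
  have hg := WeightedGaussian.isGreatest_lambdaOne hn
  have hu := WeightedGaussian.le_of_mem_gapSet hn hg.1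
  refine ⟨hg, hg.2 (WeightedGaussian.gap_mem_gapSet hn), hu.trans ?_, fun h3 => hu.trans ?_⟩
  · rw [div_le_one (by linarith)]
    linarith
  · have h3' : (3 : ℝ) ≤ n := by exact_mod_cast h3
    exact one_div_le_one_div_of_le (by linarith) (by linarith)
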